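/- Let $C$ be the space of continuous $2\pi$-periodic functions $g:\mathbb R\to\mathbb R$ with $\|g\|_C=\max_t|g(t)|$. For $\alpha>0$, $r\in(0,1)$, $\beta\in\mathbb R$ put $$P_{\alpha,r,\beta}(t)=\sum_{k=1}^{\infty}e^{-\alpha k^{r}}\cos\Big(kt-\frac{\beta\pi}{2}\Big),$$ and let $C^{\alpha,r}_{\beta}C$ be the set of all $2\pi$-periodic functions $f$ that can be represented, for all $x\in\mathbb R$, as $$f(x)=\frac{a_0}{2}+\frac1\pi\int_{-\pi}^{\pi}P_{\alpha,r,\beta}(x-t)\varphi(t)\,dt,\qquad a_0\in\mathbb R,\ \varphi\in C,\ \int_{-\pi}^{\pi}\varphi(t)\,dt=0;$$ the function $\varphi$ is denoted by $f^{\alpha,r}_{\beta}$. Let $S_{n-1}(f)$ be the partial Fourier sum of $f$ of order $n-1$, let $\rho_n(f;x)=f(x)-S_{n-1}(f;x)$, and let $E_n(\varphi)_C=\inf_{T}\|\varphi-T\|_C$, where $T$ runs over the real trigonometric polynomials of order at most $n-1$. Let $n_1=n_1(\alpha,r)$ be the smallest integer $n\ge 1$ such that $$\frac{1}{\alpha r}\,\frac{1}{n^{r}}\Big(1+\ln\frac{\pi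 n^{1-r}}{\alpha r}\Big)+\frac{\alpha r}{n^{1-r}}\le\frac{1}{(3\pi)^3}.$$ **Theorem 1.** Let $\alpha>0$, $r\in(0,1)$, $\beta\in\mathbb R$, and let $n$ be an integer with $n\ge n_1(\alpha,r)$. (i) There is a number $\gamma_n=\gamma_n(\alpha,r,\beta)$ with $|\gamma_n|\le 20\pi^4$ such that for every $f\in C^{\alpha,r}_{\beta}C$ $$\|\rho_n(f;\cdot)\|_C\le e^{-\alpha n^{r}}\Big(\frac{4}{\pi^2}\ln\frac{n^{1-r}}{\alpha r}+\gamma_n\Big)E_n(f^{\alpha,r}_{\beta})_C .$$ (ii) There is a number $\tilde\gamma_n=\tilde\gamma_n(\alpha,r,\beta)$ with $|\tilde\gamma_n|\le 20\pi^4$ such that for every $f\in C^{\alpha,r}_{\beta}C$ there is a function $F=F(f,n,\cdot)\in C^{\alpha,r}_{\beta}C$ with $E_n(F^{\alpha,r}_{\beta})_C=E_n(f^{\alpha,r}_{\beta})_C$ and $$\|\rho_n(F;\cdot)\|_C= e^{-\alpha n^{r}}\Big(\frac{4}{\pi^2}\ln\frac{n^{1-r}}{\alpha r}+\tilde\gamma_n\Big)E_n(f^{\alpha,r}_{\beta})_C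 .$$ -/

import Mathlib

namespace GenPoisson

open Real Filter Topology

noncomputable section

/-- The space `C`: continuous `2π`-periodic functions on the real line. -/
def IsCont2Pi (g : ℝ → ℝ) : Prop :=
  Continuous g ∧ Function.Periodic g (2 * π)

/-- The uniform norm `‖g‖_C`; it is the maximum of `|g|` for `g` in `C`. -/
def normC (g : ℝ → ℝ) : ℝ := ⨆ x : ℝ, |g x|

/-- Fourier cosine coefficients `a_k(f)`. -/
def cosCoeff (f : ℝ → ℝ) (k : ℕ) : ℝ :=
  (1 / π) * ∫ t in (-π)..π, f t * cos (k * t)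

/-- Fourier sine coefficients `b_k(f)`. -/
def sinCoeff (f : ℝ → ℝ) (k : ℕ) : ℝ :=
  (1 / π) * ∫ t in (-π)..π, f t * sin (k * t)

/-- The partial Fourier sum `S_m(f; x)` of order `m`. -/
def fourierSum (m : ℕ) (f : ℝ → ℝ) (x : ℝ) : ℝ :=
  cosCoeff f 0 / 2 +
    ∑ k ∈ Finset.Icc 1 m, (cosCoeff f k * cos (k * x) + sinCoeff f k * sin (k * x))

/-- The deviation `ρ_n(f; x) = f(x) - S_{n-1}(f; x)`, for `n ≥ 1`. -/
def rho (n : ℕ) (f : ℝ → ℝ) (x : ℝ) : ℝ := f x - fourierSum (n - 1) f x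

/-- Real trigonometric polynomials of order (at most) `m`, a space of dimension `2m+1`. -/
def trigPolys (m : ℕ) : Set (ℝ → ℝ) :=
  {T | ∃ a b : ℕ → ℝ, ∀ x, T x =
    a 0 / 2 + ∑ k ∈ Finset.Icc 1 m, (a k * cos (k * x) + b k * sin (k * x))}

/-- The best uniform approximation `E_n(φ)_C` of `φ` by trigonometric polynomials of
order `n - 1`, for `n ≥ 1`. -/
def bestApprox (n : ℕ) (φ : ℝ → ℝ) : ℝ :=
  sInf {d : ℝ | ∃ T ∈ trigPolys (n - 1), d = normC (fun x => φ x - T x)}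

/-- The generalized Poisson kernel `P_{α,r,β}(t) = ∑_{k ≥ 1} e^{-α k^r} cos(kt - βπ/2)`
(the summation index is shifted by one). -/
def kernel (α r β t : ℝ) : ℝ :=
  ∑' k : ℕ, exp (-α * ((k + 1 : ℕ) : ℝ) ^ r) * cos (((k + 1 : ℕ) : ℝ) * t - β * π / 2)

/-- `φ` is the generalized derivative `f^{α,r}_β` of the `2π`-periodic function `f`: it belongs
to `C`, has mean value zero, and `f` is, up to a constant, the convolution of `φ` with the
generalized Poisson kernel. -/
def IsGenDeriv (α r β : ℝ) (f φ : ℝ → ℝ) : Prop :=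
  IsCont2Pi φ ∧ (∫ t in (-π)..π, φ t) = 0 ∧ Function.Periodic f (2 * π) ∧
    ∃ a₀ : ℝ, ∀ x : ℝ,
      f x = a₀ / 2 + (1 / π) * ∫ t in (-π)..π, kernel α r β (x - t) * φ t

/-- The class `C^{α,r}_β C` of generalized Poisson integrals of functions from `C`. -/
def genPoissonClass (α r β : ℝ) : Set (ℝ → ℝ) :=
  {f | ∃ φ : ℝ → ℝ, IsGenDeriv α r β f φ}

/-- The condition on `n` that defines the number `n₁(α, r)`. -/
def n₁Cond (α r : ℝ) (n : ℕ) : Prop :=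
  1 / (α * r) * (1 / (n : ℝ) ^ r) * (1 + log (π * (n : ℝ) ^ (1 - r) / (α * r)))
    + α * r / (n : ℝ) ^ (1 - r) ≤ 1 / (3 * π) ^ 3

/-- `n₁(α, r)`: the smallest positive integer that satisfies the condition. -/
def n₁ (α r : ℝ) : ℕ := sInf {n : ℕ | 1 ≤ n ∧ n₁Cond α r n}

/-- The smallest such integer exists, so that `n₁` has no default value. -/
theorem n₁_isLeast {α r : ℝ} (hα : 0 < α) (hr : r ∈ Set.Ioo (0 : ℝ) 1) :
    IsLeast {n : ℕ | 1 ≤ n ∧ n₁Cond α r n} (n₁ α r) := by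
  obtain ⟨hr0, hr1⟩ := hr
  have hA : 0 < α * r := mul_pos hα hr0
  have e1 : Tendsto (fun x : ℝ => 1 / x ^ r) atTop (𝓝 0) :=
    (tendsto_rpow_atTop hr0).const_div_atTop _
  have e2 : Tendsto (fun x : ℝ => log x / x ^ r) atTop (𝓝 0) :=
    (isLittleO_log_rpow_atTop hr0).tendsto_div_nhds_zero
  have e3 : Tendsto (fun x : ℝ => α * r / x ^ (1 - r)) atTop (𝓝 0) :=
    (tendsto_rpow_atTop (by linarith)).const_div_atTop _
  have e4 : Tendsto (fun x : ℝ => 1 / (α * r) * (1 + log (π / (α * r))) * (1 / x ^ r)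
      + 1 / (α * r) * (1 - r) * (log x / x ^ r) + α * r / x ^ (1 - r)) atTop (𝓝 0) := by
    simpa using ((e1.const_mul _).add (e2.const_mul _)).add e3
  have e5 := e4.comp tendsto_natCast_atTop_atTop
  have hpos : (0 : ℝ) < 1 / (3 * π) ^ 3 := by positivity
  obtain ⟨n, hn, hn1⟩ := ((e5.eventually_le_const hpos).and (eventually_ge_atTop 1)).exists
  have hnpos : (0 : ℝ) < n := by exact_mod_cast hn1
  have hne : {n : ℕ | 1 ≤ n ∧ n₁Cond α r n}.Nonempty := by
    refine ⟨n, hn1, ?_⟩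
    have hl : log (π * (n : ℝ) ^ (1 - r) / (α * r)) = log (π / (α * r)) + (1 - r) * log n := by
      rw [mul_div_right_comm, log_mul (by positivity) (by positivity), log_rpow hnpos]
    unfold n₁Cond
    rw [hl]
    refine le_of_eq_of_le ?_ hn
    simp only [Function.comp]
    ring
  exact ⟨Nat.sInf_mem hne, fun m hm => Nat.sInf_le hm⟩

end

end GenPoisson

open GenPoisson

/-! Put `q = e^{-α n^r}`, `θ = βπ/2`, `c = αr / n^{1-r}`, and let `K` be the part of the kernel with
frequencies at least `n`. Then `ρ_n(f)` is the convolution of `K` with `φ`, divided by `π`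
(`rho_eq_convolution`). Since `K` is orthogonal to polynomials of order `n - 1`, `φ` may be replaced
by `φ - T`, so `‖ρ_n(f)‖ ≤ I · E_n(φ)` with `I = ‖K‖₁ / π` (`abs_rho_le`). The constant `I` is sharp
up to any `ε`: a continuous substitute for the sign of `K` nearly attains it
(`exists_genDeriv_near_extremal`).

It remains to show `|I - q · (4/π²) log (1/c)| ≤ 100 q` (`abs_norm_trigKernel_truncWeight_sub_le`).
Write `K(t) = q Re (e^{i(nt-θ)} D(t))`, where `D(t) = ∑ a_k e^{ikt}` and `a_k = e^{-α(n+k)^r} / q`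
is decreasing and convex with `a_0 = 1`, `a_0 - a_1 ≤ c` and `∑ a_k ≤ 3/c`. Two summations by parts
give `D(t) = i/t + O(1 + c/t²)` (`norm_tsum_exp_sub_le`). Hence `|K|/q` is `|sin (nt - θ)| / |t|` up
to an error whose integral over `c ≤ |t| ≤ π` is bounded, and `|t| ≤ c` contributes a bounded amount
because `|D| ≤ 3/c`. As `|sin|` has mean `2/π`, each side contributes `(2/π) log (π/c)` up to
`O(1/(nc))` (`abs_integral_abs_sin_div_sub_le`). From `n ≥ n₁` only `c ≤ 1` and `nc = αr n^r ≥ 2`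
are needed. -/

namespace GenPoisson
open Real Filter Topology
noncomputable section

/-! ### Power series with convex coefficients on the unit circle -/

/-- Summation by parts for a power series at a point of the closed unit disc. -/
theorem one_sub_mul_tsum {a : ℕ → ℝ} (ha : Summable a) (h0 : ∀ k, 0 ≤ a k) {z : ℂ} (hz : ‖z‖ ≤ 1) :
    (1 - z) * ∑' k, (a k : ℂ) * z ^ k
      = a 0 - z * ∑' k, ((a k - a (k + 1) : ℝ) : ℂ) * z ^ k := by
  have hs : ∀ b : ℕ → ℝ, Summable b → (∀ k, 0 ≤ b k) → Summable fun k => (b k : ℂ) * z ^ k := by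
    intro b hb hb0
    refine Summable.of_norm_bounded hb fun k => ?_
    rw [norm_mul, norm_pow, Complex.norm_real, norm_of_nonneg (hb0 k)]
    exact mul_le_of_le_one_right (hb0 k) (pow_le_one₀ (norm_nonneg _) hz)
  have hs0 := hs a ha h0
  have hs1 := hs (fun k => a (k + 1)) ((summable_nat_add_iff 1).2 ha) fun k => h0 _
  have e1 : ∑' k, ((a k - a (k + 1) : ℝ) : ℂ) * z ^ k
      = ∑' k, (a k : ℂ) * z ^ k - ∑' k, (a (k + 1) : ℂ) * z ^ k := by
    rw [← hs0.tsum_sub hs1]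
    exact tsum_congr fun k => by push_cast; ring
  have e2 : ∑' k, (a k : ℂ) * z ^ k = a 0 + z * ∑' k, (a (k + 1) : ℂ) * z ^ k := by
    rw [hs0.tsum_eq_zero_add, ← tsum_mul_left]
    simp only [pow_zero, mul_one]
    congr 1
    exact tsum_congr fun k => by ring
  rw [e1]
  linear_combination e2

/-- After one summation by parts the new coefficients are nonnegative and telescope to `d 0`. -/
theorem norm_tsum_le_of_antitone {d : ℕ → ℝ} (hd : Summable d) (h0 : ∀ k, 0 ≤ d k)
    (hanti : Antitone d) {z : ℂ} (hz : ‖z‖ ≤ 1) :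
    ‖1 - z‖ * ‖∑' k, (d k : ℂ) * z ^ k‖ ≤ 2 * d 0 := by
  have hd1 := (summable_nat_add_iff 1).2 hd
  have hdiff : ∀ k, 0 ≤ d k - d (k + 1) := fun k => sub_nonneg.2 (hanti (Nat.le_succ k))
  have hsub : HasSum (fun k => d k - d (k + 1)) (d 0) := by
    have := hd.hasSum.sub hd1.hasSum
    rwa [hd.tsum_eq_zero_add, add_sub_cancel_right] at this
  have hb : ‖∑' k, ((d k - d (k + 1) : ℝ) : ℂ) * z ^ k‖ ≤ d 0 := by
    refine tsum_of_norm_bounded hsub fun k => ?_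
    rw [norm_mul, norm_pow, Complex.norm_real, norm_of_nonneg (hdiff k)]
    exact mul_le_of_le_one_right (hdiff k) (pow_le_one₀ (norm_nonneg _) hz)
  rw [← norm_mul, one_sub_mul_tsum hd h0 hz]
  refine (norm_sub_le _ _).trans ?_
  rw [norm_mul, Complex.norm_real, norm_of_nonneg (h0 0)]
  have := mul_le_mul hz hb (norm_nonneg _) zero_le_one
  linarith

/-- Multiplying the difference by `1 - z` leaves, up to the factor `-z`, the series of first
differences. By convexity these decrease, so a second summation by parts gains another factor `1 /
‖1 - z‖`. -/
theorem norm_tsum_sub_inv_le {a : ℕ → ℝ} (ha : Summable a) (h0 : ∀ k, 0 ≤ a k) (ha0 : a 0 = 1)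
    (hanti : Antitone a) (hconv : Antitone fun k => a k - a (k + 1)) {z : ℂ} (hz : ‖z‖ ≤ 1)
    (hz1 : z ≠ 1) :
    ‖∑' k, (a k : ℂ) * z ^ k - (1 - z)⁻¹‖ ≤ 2 * (a 0 - a 1) / ‖1 - z‖ ^ 2 := by
  have hz2 : 1 - z ≠ 0 := sub_ne_zero.2 hz1.symm
  have hpos : 0 < ‖1 - z‖ := norm_pos_iff.2 hz2
  have hb := norm_tsum_le_of_antitone (d := fun k => a k - a (k + 1))
    (ha.sub ((summable_nat_add_iff 1).2 ha)) (fun k => sub_nonneg.2 (hanti (Nat.le_succ k))) hconv hz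
  have e := one_sub_mul_tsum ha h0 hz
  rw [le_div_iff₀ (by positivity)]
  have e2 : (1 - z) * (∑' k, (a k : ℂ) * z ^ k - (1 - z)⁻¹)
      = - (z * ∑' k, ((a k - a (k + 1) : ℝ) : ℂ) * z ^ k) := by
    rw [mul_sub, e, mul_inv_cancel₀ hz2, ha0]; push_cast; ring
  calc _ = ‖1 - z‖ * ‖(1 - z) * (∑' k, (a k : ℂ) * z ^ k - (1 - z)⁻¹)‖ := by
        rw [norm_mul]; ring
    _ = ‖z‖ * (‖1 - z‖ * ‖∑' k, ((a k - a (k + 1) : ℝ) : ℂ) * z ^ k‖) := by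
        rw [e2, norm_neg, norm_mul]; ring
    _ ≤ 1 * (2 * (a 0 - a 1)) := by
        refine mul_le_mul hz hb (by positivity) zero_le_one
    _ = _ := one_mul _

theorem two_div_pi_mul_abs_le_norm {t : ℝ} (ht : |t| ≤ π) :
    2 / π * |t| ≤ ‖1 - Complex.exp (t * Complex.I)‖ := by
  rw [norm_sub_rev, mul_comm (t : ℂ), Complex.norm_exp_I_mul_ofReal_sub_one, norm_eq_abs, abs_mul,
    abs_two]
  have h := mul_abs_le_abs_sin (x := t / 2) (by rw [abs_div, abs_two]; linarith)
  rw [abs_div, abs_two] at h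
  linarith

theorem norm_exp_sub_one_sub_le (t : ℝ) :
    ‖Complex.exp (t * Complex.I) - 1 - t * Complex.I‖ ≤ 3 * t ^ 2 := by
  have hn : ‖(t : ℂ) * Complex.I‖ = |t| := by simp
  rcases le_total |t| 1 with h | h
  · have := Complex.norm_exp_sub_one_sub_id_le (x := t * Complex.I) (by rw [hn]; exact h)
    rw [hn, sq_abs] at this
    nlinarith [sq_nonneg t]
  · have h1 := norm_sub_le (Complex.exp (t * Complex.I) - 1) (t * Complex.I)
    have h2 := norm_sub_le (Complex.exp (t * Complex.I)) 1
    rw [Complex.norm_exp_ofReal_mul_I, norm_one] at h2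
    rw [hn] at h1
    nlinarith [sq_abs t]

/-- Over the common denominator `t (1 - e^{it})`, of modulus at least `(2/π) t²`, the numerator is a
second-order Taylor remainder, at most `3 t²`. -/
theorem norm_inv_one_sub_exp_sub_le {t : ℝ} (ht0 : t ≠ 0) (ht : |t| ≤ π) :
    ‖(1 - Complex.exp (t * Complex.I))⁻¹ - Complex.I / t‖ ≤ 3 * π / 2 := by
  have hl := two_div_pi_mul_abs_le_norm ht
  have htp : 0 < |t| := abs_pos.2 ht0
  have hpos : 0 < 2 / π * |t| := by positivity
  have hz : 1 - Complex.exp (t * Complex.I) ≠ 0 := norm_pos_iff.1 (hpos.trans_le hl)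
  have htc : (t : ℂ) ≠ 0 := by exact_mod_cast ht0
  have e : (1 - Complex.exp (t * Complex.I))⁻¹ - Complex.I / t
      = Complex.I * (Complex.exp (t * Complex.I) - 1 - t * Complex.I)
        / (t * (1 - Complex.exp (t * Complex.I))) := by
    field_simp
    linear_combination (t : ℂ) * Complex.I_sq
  rw [e, norm_div, norm_mul, norm_mul, Complex.norm_I, one_mul, Complex.norm_real, norm_eq_abs,
    div_le_iff₀ (by positivity)]
  refine (norm_exp_sub_one_sub_le t).trans ?_
  calc 3 * t ^ 2 = 3 * π / 2 * (|t| * (2 / π * |t|)) := by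
        rw [← sq_abs t]; field_simp
    _ ≤ _ := by gcongr

theorem norm_tsum_exp_sub_le {a : ℕ → ℝ} (ha : Summable a) (h0 : ∀ k, 0 ≤ a k) (ha0 : a 0 = 1)
    (hanti : Antitone a) (hconv : Antitone fun k => a k - a (k + 1)) {c : ℝ} (hc : a 0 - a 1 ≤ c)
    {t : ℝ} (ht0 : t ≠ 0) (ht : |t| ≤ π) :
    ‖∑' k, (a k : ℂ) * Complex.exp (t * Complex.I) ^ k - Complex.I / t‖
      ≤ 3 * π / 2 + π ^ 2 / 2 * c / t ^ 2 := by
  have hl := two_div_pi_mul_abs_le_norm ht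
  have htp : 0 < |t| := abs_pos.2 ht0
  have hpos : 0 < 2 / π * |t| := by positivity
  have hz : Complex.exp (t * Complex.I) ≠ 1 := by
    intro h; rw [h, sub_self, norm_zero] at hl; linarith
  have h1 := norm_tsum_sub_inv_le ha h0 ha0 hanti hconv
    (Complex.norm_exp_ofReal_mul_I t).le hz
  have h2 := norm_inv_one_sub_exp_sub_le ht0 ht
  have hd : 0 ≤ a 0 - a 1 := sub_nonneg.2 (hanti (Nat.zero_le 1))
  have hc0 : 0 ≤ 2 * c := by linarith
  have h3 : 2 * (a 0 - a 1) / ‖1 - Complex.exp (t * Complex.I)‖ ^ 2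
      ≤ π ^ 2 / 2 * c / t ^ 2 := by
    calc _ ≤ 2 * c / (2 / π * |t|) ^ 2 := by gcongr
      _ = _ := by rw [mul_pow, sq_abs]; field_simp
  have h4 := norm_sub_le_norm_sub_add_norm_sub
    (∑' k, (a k : ℂ) * Complex.exp (t * Complex.I) ^ k) ((1 - Complex.exp (t * Complex.I))⁻¹)
    (Complex.I / t)
  linarith

/-! ### The mean value of `|sin|` against `1/t` -/

/-- The integrand has period `π` and mean zero, so its primitive is `π`-periodic and need only be
bounded on `[0, π)`, where the integrand is at most `1` in modulus. -/
theorem abs_integral_abs_sin_sub_le (x : ℝ) : |∫ t in (0 : ℝ)..x, (|sin t| - 2 / π)| ≤ π := by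
  set g : ℝ → ℝ := fun t => |sin t| - 2 / π with hg
  have hcont : Continuous g := by fun_prop
  have hint : ∀ a b, IntervalIntegrable g MeasureTheory.volume a b := fun a b =>
    hcont.intervalIntegrable a b
  have hper : Function.Periodic g π := fun t => by simp [hg, sin_add_pi]
  have hzero : ∫ t in (0 : ℝ)..π, g t = 0 := by
    have e : ∫ t in (0 : ℝ)..π, g t = ∫ t in (0 : ℝ)..π, (sin t - 2 / π) := by
      refine intervalIntegral.integral_congr fun t ht => ?_
      rw [Set.uIcc_of_le pi_pos.le] at ht
      simp only [hg]
      rw [abs_of_nonneg (sin_nonneg_of_nonneg_of_le_pi ht.1 ht.2)]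
    rw [e, intervalIntegral.integral_sub (continuous_sin.intervalIntegrable _ _) (by simp),
      integral_sin, intervalIntegral.integral_const]
    simp
    field_simp
    norm_num
  have hG : Function.Periodic (fun x => ∫ t in (0 : ℝ)..x, g t) π := by
    intro y
    change ∫ t in (0 : ℝ)..(y + π), g t = _
    rw [← intervalIntegral.integral_add_adjacent_intervals (hint 0 y) (hint y (y + π)),
      hper.intervalIntegral_add_eq y 0, zero_add, hzero, add_zero]
  obtain ⟨y, hy, hxy⟩ := hG.exists_mem_Ico₀ pi_pos x
  have hb : ∀ t ∈ Set.uIoc 0 y, ‖g t‖ ≤ 1 := by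
    intro t _
    have h1 := abs_nonneg (sin t)
    have h2 := abs_sin_le_one t
    have h3 : 2 / π ≤ 1 := by rw [div_le_one pi_pos]; exact two_le_pi
    have h4 : 0 ≤ 2 / π := by positivity
    rw [norm_eq_abs, abs_le]
    constructor <;> simp only [hg] <;> linarith
  have := intervalIntegral.norm_integral_le_of_norm_le_const hb
  rw [show ∫ t in (0 : ℝ)..x, g t = ∫ t in (0 : ℝ)..y, g t from hxy]
  rw [norm_eq_abs, sub_zero, abs_of_nonneg hy.1] at this
  linarith [hy.2]

/-- The term `(2/π) log (π/c)` is the integral of `(2/π)/t`. Integrating the difference by parts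
against `1/t`, with the primitive `v` bounded by `π/N`, gives boundary terms and a remainder adding
up to exactly `2π/(Nc)`. -/
theorem abs_integral_abs_sin_div_sub_le {c N θ : ℝ} (hc : 0 < c) (hcπ : c ≤ π) (hN : 0 < N) :
    |(∫ t in c..π, |sin (N * t - θ)| / t) - 2 / π * log (π / c)| ≤ 2 * π / (N * c) := by
  set H : ℝ → ℝ := fun x => ∫ t in (0 : ℝ)..x, (|sin t| - 2 / π) with hH
  have hHd : ∀ x, HasDerivAt H (|sin x| - 2 / π) x := fun x =>
    intervalIntegral.integral_hasDerivAt_right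
      ((by fun_prop : Continuous fun t => |sin t| - 2 / π).intervalIntegrable _ _)
      ((by fun_prop : Continuous fun t => |sin t| - 2 / π).stronglyMeasurableAtFilter _ _)
      (by fun_prop)
  have hHc : Continuous H := continuous_iff_continuousAt.2 fun x => (hHd x).continuousAt
  have hHb : ∀ x, |H x| ≤ π := abs_integral_abs_sin_sub_le
  have hπ := pi_pos
  have hpos : ∀ t ∈ Set.uIcc c π, 0 < t := fun t ht => by
    rw [Set.uIcc_of_le hcπ] at ht; linarith [ht.1]
  set v : ℝ → ℝ := fun t => H (N * t - θ) / N with hv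
  have hvd : ∀ t, HasDerivAt v (|sin (N * t - θ)| - 2 / π) t := fun t => by
    have h1 : HasDerivAt (fun t => N * t - θ) N t := by
      simpa using ((hasDerivAt_id t).const_mul N).sub_const θ
    have := ((hHd (N * t - θ)).comp t h1).div_const N
    rwa [mul_div_cancel_right₀ _ hN.ne'] at this
  have hvb : ∀ t, |v t| ≤ π / N := fun t => by
    simp only [hv]
    rw [abs_div, abs_of_pos hN]
    gcongr
    exact hHb _
  have hvc : Continuous v := by simp only [hv]; fun_prop
  have hinv2 : ContinuousOn (fun t : ℝ => (t ^ 2)⁻¹) (Set.uIcc c π) :=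
    ContinuousOn.inv₀ (by fun_prop) fun t ht => (pow_pos (hpos t ht) 2).ne'
  have hinv : ContinuousOn (fun t : ℝ => t⁻¹) (Set.uIcc c π) :=
    ContinuousOn.inv₀ (by fun_prop) fun t ht => (hpos t ht).ne'
  have hsplit : (∫ t in c..π, |sin (N * t - θ)| / t) - 2 / π * log (π / c)
      = ∫ t in c..π, t⁻¹ * (|sin (N * t - θ)| - 2 / π) := by
    have h2 : 2 / π * log (π / c) = ∫ t in c..π, 2 / π * t⁻¹ := by
      rw [intervalIntegral.integral_const_mul, integral_inv_of_pos hc hπ]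
    rw [h2, ← intervalIntegral.integral_sub]
    · exact intervalIntegral.integral_congr fun t _ => by ring
    · simp only [div_eq_mul_inv]
      exact (ContinuousOn.mul (by fun_prop) hinv).intervalIntegrable
    · exact (ContinuousOn.mul (by fun_prop) hinv).intervalIntegrable
  have hparts := intervalIntegral.integral_mul_deriv_eq_deriv_mul (a := c) (b := π)
    (u := fun t => t⁻¹) (v := v) (u' := fun t => -(t ^ 2)⁻¹) (v' := fun t => |sin (N * t - θ)| - 2 / π)
    (fun t ht => hasDerivAt_inv (hpos t ht).ne') (fun t _ => hvd t)
    hinv2.neg.intervalIntegrable ((by fun_prop : Continuous _).intervalIntegrable _ _)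
  have hint2 : ∫ t in c..π, (t ^ 2)⁻¹ = c⁻¹ - π⁻¹ := by
    have := intervalIntegral.integral_eq_sub_of_hasDerivAt (a := c) (b := π)
      (f := fun t => -t⁻¹) (f' := fun t => (t ^ 2)⁻¹)
      (fun t ht => by simpa using (hasDerivAt_inv (hpos t ht).ne').fun_neg) hinv2.intervalIntegrable
    rw [this]; ring
  have hrem : |∫ t in c..π, -(t ^ 2)⁻¹ * v t| ≤ π / N * (c⁻¹ - π⁻¹) := by
    rw [← hint2, ← intervalIntegral.integral_const_mul, ← norm_eq_abs]
    refine intervalIntegral.norm_integral_le_of_norm_le hcπ (.of_forall fun t ht => ?_)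
      (ContinuousOn.mul (by fun_prop) hinv2).intervalIntegrable
    rw [norm_mul, norm_neg, norm_of_nonneg (by positivity), norm_eq_abs, mul_comm]
    gcongr
    exact hvb t
  rw [hsplit, hparts]
  have h1 : |π⁻¹ * v π| ≤ π⁻¹ * (π / N) := by
    rw [abs_mul, abs_of_pos (inv_pos.2 hπ)]; gcongr; exact hvb _
  have h2 : |c⁻¹ * v c| ≤ c⁻¹ * (π / N) := by
    rw [abs_mul, abs_of_pos (inv_pos.2 hc)]; gcongr; exact hvb _
  have h3 : 2 * π / (N * c) = π⁻¹ * (π / N) + c⁻¹ * (π / N) + π / N * (c⁻¹ - π⁻¹) := by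
    field_simp; ring
  rw [h3]
  refine (abs_sub _ _).trans (add_le_add ((abs_sub _ _).trans (add_le_add h1 h2)) hrem)

/-! ### Consequences of `n ≥ n₁` -/

/-- The defining condition is used at `n₁` itself only; both resulting bounds are monotone in `n`,
so they pass to all larger integers. -/
theorem one_le_n₁_and_bounds {α r : ℝ} (hα : 0 < α) (hr : r ∈ Set.Ioo (0 : ℝ) 1) {n : ℕ}
    (hn : n₁ α r ≤ n) :
    1 ≤ n ∧ α * r / (n : ℝ) ^ (1 - r) ≤ 1 ∧ 2 ≤ α * r * (n : ℝ) ^ r := by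
  obtain ⟨⟨h1, hcond⟩, -⟩ := n₁_isLeast hα hr
  obtain ⟨hr0, hr1⟩ := hr
  set m := n₁ α r
  have hA : 0 < α * r := mul_pos hα hr0
  have hm : (1 : ℝ) ≤ m := by exact_mod_cast h1
  have hm0 : (0 : ℝ) < m := by linarith
  have hmn : (m : ℝ) ≤ n := by exact_mod_cast hn
  have hx : 0 < (m : ℝ) ^ r := by positivity
  have hy : 0 < (m : ℝ) ^ (1 - r) := by positivity
  have hy1 : 1 ≤ (m : ℝ) ^ (1 - r) := one_le_rpow hm (by linarith)
  have hx1 : 1 ≤ (m : ℝ) ^ r := one_le_rpow hm hr0.le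
  set c := α * r / (m : ℝ) ^ (1 - r) with hc
  have hc0 : 0 < c := by positivity
  set M := α * r * (m : ℝ) ^ r with hM
  have hM0 : 0 < M := by positivity
  have hcM : c ≤ M := by
    calc c ≤ α * r := div_le_self hA.le hy1
      _ ≤ M := le_mul_of_one_le_right hA.le hx1
  have hδ : 1 / (3 * π) ^ 3 ≤ 1 / 2 := by
    have h9 : 2 ≤ 3 * π := by linarith [pi_gt_three]
    have := pow_le_pow_left₀ (by norm_num) h9 3
    exact one_div_le_one_div_of_le (by norm_num) (by linarith)
  have hcond' : (1 + log (π / c)) / M + c ≤ 1 / 2 := by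
    refine le_trans (le_of_eq ?_) (hcond.trans hδ)
    rw [hM, hc, div_div_eq_mul_div]
    field_simp
  -- The logarithm might be negative when `c` is large, but then `log (c/π) ≤ c/π - 1` together with
  -- `c ≤ M` keeps the first summand above `-1/π`, so `c ≤ 1/2 + 1/π ≤ 1`.
  have hc1 : c ≤ 1 := by
    by_contra! hlt
    have h2 := log_le_sub_one_of_pos (x := c / π) (by positivity)
    have h3 : log (π / c) = - log (c / π) := by rw [← log_inv, inv_div]
    have h4 : -(c / π) / M ≤ (1 + log (π / c)) / M := by gcongr; linarith
    have h5 : c / π / M ≤ 1 / π := by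
      rw [div_div, mul_comm, ← div_div]
      gcongr
      rw [div_le_one hM0]; exact hcM
    have h6 : 1 / π ≤ 1 / 2 := one_div_le_one_div_of_le (by norm_num) two_le_pi
    rw [neg_div] at h4
    linarith
  have hlog : 0 ≤ log (π / c) := by
    refine log_nonneg ?_
    rw [one_le_div hc0]; linarith [pi_gt_three]
  have hM2 : 2 ≤ M := by
    have h1 : 1 / M ≤ (1 + log (π / c)) / M := by gcongr; linarith
    have h2 : 1 / M ≤ 1 / 2 := by linarith
    exact le_of_one_div_le_one_div hM0 h2
  refine ⟨h1.trans hn, le_trans ?_ hc1, le_trans hM2 ?_⟩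
  · rw [hc]; gcongr
  · rw [hM]; gcongr

/-! ### Convexity, decrements and tail sums of the multipliers -/

/-- The sequence `e^{-α x^r}` of Fourier multipliers, as a function on the half line. -/
def expRpow (α r x : ℝ) : ℝ := exp (-α * x ^ r)

theorem expRpow_pos (α r x : ℝ) : 0 < expRpow α r x := exp_pos _

theorem convexOn_expRpow {α r : ℝ} (hα : 0 < α) (hr : r ∈ Set.Ioo (0 : ℝ) 1) :
    ConvexOn ℝ (Set.Ici 0) (expRpow α r) := by
  have h1 : ConvexOn ℝ (Set.Ici 0) fun x : ℝ => -α * x ^ r := by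
    have := (Real.concaveOn_rpow hr.1.le hr.2.le).neg.smul hα.le
    refine this.congr fun x _ => ?_
    simp
  refine ⟨convex_Ici 0, fun x hx y hy a b ha hb hab => ?_⟩
  exact (exp_le_exp.2 (h1.2 hx hy ha hb hab)).trans
    (convexOn_exp.2 (Set.mem_univ _) (Set.mem_univ _) ha hb hab)

theorem expRpow_anti {α r x y : ℝ} (hα : 0 < α) (hr : r ∈ Set.Ioo (0 : ℝ) 1) (hx : 0 ≤ x)
    (hxy : x ≤ y) : expRpow α r y ≤ expRpow α r x := by
  refine exp_le_exp.2 ?_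
  have := mul_le_mul_of_nonneg_left (rpow_le_rpow hx hxy hr.1.le) hα.le
  linarith

theorem expRpow_diff_anti {α r x : ℝ} (hα : 0 < α) (hr : r ∈ Set.Ioo (0 : ℝ) 1) (hx : 0 ≤ x) :
    expRpow α r (x + 1) - expRpow α r (x + 2) ≤ expRpow α r x - expRpow α r (x + 1) := by
  obtain ⟨-, hconv⟩ := convexOn_expRpow hα hr
  have := @hconv x hx (x + 2) (Set.mem_Ici.2 (by linarith)) (1 / 2) (1 / 2) (by norm_num)
    (by norm_num) (by norm_num)
  simp only [smul_eq_mul] at this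
  rw [show 1 / 2 * x + 1 / 2 * (x + 2) = x + 1 by ring] at this
  linarith

/-- Bernoulli's inequality bounds the increment of `x ^ r` by `r / x ^ (1 - r)`, and `1 - e^{-u} ≤
u` does the rest. -/
theorem expRpow_sub_le {α r x : ℝ} (hα : 0 < α) (hr : r ∈ Set.Ioo (0 : ℝ) 1) (hx : 0 < x) :
    expRpow α r x - expRpow α r (x + 1) ≤ α * r / x ^ (1 - r) * expRpow α r x := by
  have h1 : (x + 1) ^ r ≤ x ^ r + r / x ^ (1 - r) := by
    have h := rpow_one_add_le_one_add_mul_self (s := 1 / x) (by have : 0 < 1 / x := by positivity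
                                                                linarith) hr.1.le hr.2.le
    have e : x + 1 = x * (1 + 1 / x) := by field_simp
    rw [e, mul_rpow hx.le (by positivity)]
    calc _ ≤ x ^ r * (1 + r * (1 / x)) := by gcongr
      _ = x ^ r + r * (x ^ r / x) := by ring
      _ = _ := by
        rw [← rpow_sub_one hx.ne', show r - 1 = -(1 - r) by ring, rpow_neg hx.le, div_eq_mul_inv r]
  have h2 : expRpow α r (x + 1) = expRpow α r x * exp (-(α * ((x + 1) ^ r - x ^ r))) := by
    rw [expRpow, expRpow, ← exp_add]; congr 1; ring
  have h3 := add_one_le_exp (-(α * ((x + 1) ^ r - x ^ r)))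
  have h4 : α * ((x + 1) ^ r - x ^ r) ≤ α * r / x ^ (1 - r) := by
    rw [mul_div_assoc]; gcongr; linarith
  rw [h2]
  nlinarith [expRpow_pos α r x]

/-- A telescoping majorant, which replaces comparison with an integral. The function `G(y) = e^{-α
y^r} y^{1-r}` has derivative `e^{-α y^r} (-αr + (1-r)/y^r)`, and `hM` makes this at most `-(αr/2)
e^{-α y^r}` beyond `x`; the mean value theorem then applies on `[x, x + 1]`. -/
theorem expRpow_succ_le {α r x : ℝ} (hα : 0 < α) (hr : r ∈ Set.Ioo (0 : ℝ) 1) (hx : 0 < x)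
    (hM : 2 ≤ α * r * x ^ r) :
    expRpow α r (x + 1) ≤ 2 / (α * r) * (expRpow α r x * x ^ (1 - r))
      - 2 / (α * r) * (expRpow α r (x + 1) * (x + 1) ^ (1 - r)) := by
  have hA : 0 < α * r := mul_pos hα hr.1
  have hd : ∀ y, 0 < y → HasDerivAt (fun y => expRpow α r y * y ^ (1 - r))
      (expRpow α r y * (-(α * r) + (1 - r) / y ^ r)) y := fun y hy => by
    have h1 := (((Real.hasDerivAt_rpow_const (p := r) (Or.inl hy.ne')).const_mul (-α)).exp).mul
      (Real.hasDerivAt_rpow_const (p := 1 - r) (Or.inl hy.ne'))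
    refine h1.congr_deriv ?_
    have e1 : y ^ (r - 1) * y ^ (1 - r) = 1 := by rw [← rpow_add hy]; simp
    have e2 : y ^ (1 - r - 1) = (y ^ r)⁻¹ := by rw [← rpow_neg hy.le]; congr 1; ring
    rw [e2, expRpow, div_eq_mul_inv]
    linear_combination (-exp (-α * y ^ r) * α * r) * e1
  obtain ⟨y, hy, hslope⟩ := exists_hasDerivAt_eq_slope (fun y => expRpow α r y * y ^ (1 - r))
    (fun y => expRpow α r y * (-(α * r) + (1 - r) / y ^ r)) (lt_add_one x)
    (fun y hy => (hd y (hx.trans_le hy.1)).continuousAt.continuousWithinAt)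
    (fun y hy => hd y (hx.trans hy.1))
  rw [add_sub_cancel_left, div_one] at hslope
  have hy0 : 0 < y := hx.trans hy.1
  have h1 : (1 - r) / y ^ r ≤ α * r / 2 := by
    have hyr : x ^ r ≤ y ^ r := rpow_le_rpow hx.le hy.1.le hr.1.le
    rw [div_le_iff₀ (by positivity)]
    have := mul_le_mul_of_nonneg_left hyr hA.le
    linarith [hr.1]
  have h2 := expRpow_anti hα hr hy0.le hy.2.le
  have h3 := expRpow_pos α r y
  rw [← mul_sub, ← neg_sub, ← hslope, div_mul_eq_mul_div, le_div_iff₀ hA]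
  nlinarith

theorem expRpow_sum_le {α r x : ℝ} (hα : 0 < α) (hr : r ∈ Set.Ioo (0 : ℝ) 1) (hx : 0 < x)
    (hM : 2 ≤ α * r * x ^ r) (m : ℕ) :
    ∑ k ∈ Finset.range m, expRpow α r (x + k + 1)
      ≤ 2 / (α * r) * (expRpow α r x * x ^ (1 - r))
        - 2 / (α * r) * (expRpow α r (x + m) * (x + m) ^ (1 - r)) := by
  induction m with
  | zero => simp
  | succ m ih =>
    rw [Finset.sum_range_succ]
    have hA : 0 < α * r := mul_pos hα hr.1
    have h := expRpow_succ_le hα hr (x := x + m) (by positivity) (hM.trans (by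
      gcongr
      · exact hr.1.le
      · linarith [Nat.cast_nonneg (α := ℝ) m]))
    push_cast
    rw [← add_assoc]
    linarith

/-- The terms after the first telescope to at most `2/c` times the first, where `c = αr / x^{1-r}`;
the first term costs another `1/c` because `c ≤ 1`. -/
theorem expRpow_summable_tsum_le {α r : ℝ} (hα : 0 < α) (hr : r ∈ Set.Ioo (0 : ℝ) 1) {x : ℝ}
    (hx : 0 < x) (hM : 2 ≤ α * r * x ^ r) (hc : α * r / x ^ (1 - r) ≤ 1) :
    Summable (fun k : ℕ => expRpow α r (x + k)) ∧
      ∑' k : ℕ, expRpow α r (x + k) ≤ expRpow α r x * (3 / (α * r / x ^ (1 - r))) := by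
  have hA : 0 < α * r := mul_pos hα hr.1
  have hb : ∀ m, ∑ k ∈ Finset.range m, expRpow α r (x + k + 1)
      ≤ 2 / (α * r) * (expRpow α r x * x ^ (1 - r)) := fun m => by
    have h1 := expRpow_sum_le hα hr hx hM m
    have h2 : 0 ≤ 2 / (α * r) * (expRpow α r (x + m) * (x + m) ^ (1 - r)) := by
      have := expRpow_pos α r (x + m); positivity
    linarith
  have hs1 := summable_of_sum_range_le (fun k => (expRpow_pos α r (x + k + 1)).le) hb
  have hs : Summable (fun k : ℕ => expRpow α r (x + k)) := by
    rw [← summable_nat_add_iff 1]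
    simpa [add_assoc] using hs1
  refine ⟨hs, ?_⟩
  have ht := hs1.tsum_le_of_sum_range_le hb
  rw [hs.tsum_eq_zero_add]
  have h3 : expRpow α r x * 1 ≤ expRpow α r x * (1 / (α * r / x ^ (1 - r))) := by
    refine mul_le_mul_of_nonneg_left ?_ (expRpow_pos α r x).le
    rwa [one_le_div (by positivity)]
  have e : expRpow α r x * (3 / (α * r / x ^ (1 - r)))
      = expRpow α r x * (1 / (α * r / x ^ (1 - r)))
        + 2 / (α * r) * (expRpow α r x * x ^ (1 - r)) := by
    field_simp; ring
  rw [e]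
  push_cast
  simp only [add_zero, add_assoc, mul_one] at *
  linarith

theorem expRpow_summable {α r : ℝ} (hα : 0 < α) (hr : r ∈ Set.Ioo (0 : ℝ) 1) :
    Summable fun k : ℕ => expRpow α r ((k + 1 : ℕ) : ℝ) := by
  obtain ⟨h1, hc, hM⟩ := one_le_n₁_and_bounds hα hr le_rfl
  have hs := (expRpow_summable_tsum_le hα hr (by exact_mod_cast h1) hM hc).1
  refine (summable_nat_add_iff (f := fun k : ℕ => expRpow α r (k : ℝ)) 1).2 ?_
  rw [← summable_nat_add_iff (n₁ α r)]
  refine hs.congr fun k => ?_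
  push_cast
  rw [add_comm]

/-! ### The `L¹` norm of a function close to `sin (Nt - θ) / t` -/

theorem abs_integral_sub_le_on_half {p : ℝ → ℝ} (hp : Continuous p) {c N θ : ℝ} (hc0 : 0 < c)
    (hc1 : c ≤ 1) (hN : 0 < N)
    (h : ∀ t, 0 < t → t ≤ π →
      |(|p t| - |sin (N * t - θ)| / t)| ≤ 3 * π / 2 + π ^ 2 / 2 * c / t ^ 2) :
    |(∫ t in c..π, |p t|) - 2 / π * log (π / c)| ≤ 2 * π ^ 2 + 2 * π / (N * c) := by
  have hπ := pi_pos
  have hcπ : c ≤ π := by linarith [pi_gt_three]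
  have hpos : ∀ t ∈ Set.uIcc c π, 0 < t := fun t ht => by
    rw [Set.uIcc_of_le hcπ] at ht; linarith [ht.1]
  have hinv2 : ContinuousOn (fun t : ℝ => (t ^ 2)⁻¹) (Set.uIcc c π) :=
    ContinuousOn.inv₀ (by fun_prop) fun t ht => (pow_pos (hpos t ht) 2).ne'
  have hinv : ContinuousOn (fun t : ℝ => |sin (N * t - θ)| / t) (Set.uIcc c π) :=
    ContinuousOn.div (by fun_prop) (by fun_prop) fun t ht => (hpos t ht).ne'
  have hint2 : ∫ t in c..π, (t ^ 2)⁻¹ = c⁻¹ - π⁻¹ := by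
    have := intervalIntegral.integral_eq_sub_of_hasDerivAt (a := c) (b := π)
      (f := fun t => -t⁻¹) (f' := fun t => (t ^ 2)⁻¹)
      (fun t ht => by simpa using (hasDerivAt_inv (hpos t ht).ne').fun_neg)
      hinv2.intervalIntegrable
    rw [this]; ring
  have h1 := abs_integral_abs_sin_div_sub_le (θ := θ) hc0 hcπ hN
  have h2 : |(∫ t in c..π, |p t|) - ∫ t in c..π, |sin (N * t - θ)| / t| ≤ 2 * π ^ 2 := by
    rw [← intervalIntegral.integral_sub (hp.abs.intervalIntegrable _ _) hinv.intervalIntegrable,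
      ← norm_eq_abs]
    have hbj : IntervalIntegrable (fun t => π ^ 2 / 2 * c * (t ^ 2)⁻¹)
        MeasureTheory.volume c π := (ContinuousOn.mul (by fun_prop) hinv2).intervalIntegrable
    have hbi : IntervalIntegrable (fun t => 3 * π / 2 + π ^ 2 / 2 * c * (t ^ 2)⁻¹)
        MeasureTheory.volume c π :=
      intervalIntegrable_const.add hbj
    refine (intervalIntegral.norm_integral_le_of_norm_le hcπ (.of_forall fun t ht => ?_)
      hbi).trans ?_
    · rw [norm_eq_abs, ← div_eq_mul_inv]; exact h t (hc0.trans ht.1) ht.2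
    · rw [intervalIntegral.integral_add intervalIntegrable_const hbj,
        intervalIntegral.integral_const_mul, hint2, intervalIntegral.integral_const, smul_eq_mul]
      -- Cutting at `c` is what makes this work: `c` times the integral of `1/t²` over `[c, π]`
      -- stays below `1`.
      have e : π ^ 2 / 2 * c * (c⁻¹ - π⁻¹) = π ^ 2 / 2 - π * c / 2 := by field_simp
      rw [e]
      nlinarith
  have := abs_sub_le (∫ t in c..π, |p t|) (∫ t in c..π, |sin (N * t - θ)| / t)
    (2 / π * log (π / c))
  linarith

theorem abs_integral_abs_sub_log_le {p : ℝ → ℝ} (hp : Continuous p) {c N θ : ℝ} (hc0 : 0 < c)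
    (hc1 : c ≤ 1) (hN : 0 < N) (hNc : 2 ≤ N * c) (hsmall : ∀ t, |p t| ≤ 3 / c)
    (h : ∀ t, t ≠ 0 → |t| ≤ π →
      |(|p t| - |sin (N * t - θ)| / |t|)| ≤ 3 * π / 2 + π ^ 2 / 2 * c / t ^ 2) :
    |1 / π * (∫ t in (-π)..π, |p t|) - 4 / π ^ 2 * log (1 / c)| ≤ 100 := by
  have hπ := pi_gt_three
  have hπ4 := pi_le_four
  have hint : ∀ a b, IntervalIntegrable (fun t => |p t|) MeasureTheory.volume a b := fun a b =>
    hp.abs.intervalIntegrable a b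
  have h1 := abs_integral_sub_le_on_half hp hc0 hc1 hN (θ := θ) fun t ht htπ => by
    have := h t ht.ne' (by rwa [abs_of_pos ht]); rwa [abs_of_pos ht] at this
  -- The negative half is reflected onto the positive one, which changes the sign of the phase.
  have h2 := abs_integral_sub_le_on_half (p := fun t => p (-t)) (by fun_prop) hc0 hc1 hN (θ := -θ)
    fun t ht htπ => by
      have := h (-t) (neg_ne_zero.2 ht.ne') (by rwa [abs_neg, abs_of_pos ht])
      rwa [abs_neg, abs_of_pos ht, neg_sq, show N * -t - θ = -(N * t - -θ) by ring, sin_neg,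
        abs_neg] at this
  rw [intervalIntegral.integral_comp_neg (fun t => |p t|)] at h2
  have h3 : |(∫ t in (-c)..c, |p t|)| ≤ 6 := by
    have := intervalIntegral.norm_integral_le_of_norm_le_const (a := -c) (b := c)
      (f := fun t => |p t|) (C := 3 / c) fun t _ => by rw [norm_eq_abs, abs_abs]; exact hsmall t
    rw [norm_eq_abs, sub_neg_eq_add, abs_of_pos (show 0 < c + c by linarith)] at this
    refine this.trans (le_of_eq ?_)
    field_simp; norm_num
  have hsum : ∫ t in (-π)..π, |p t|
      = (∫ t in (-π)..(-c), |p t|) + (∫ t in (-c)..c, |p t|) + ∫ t in c..π, |p t| := by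
    rw [intervalIntegral.integral_add_adjacent_intervals (hint _ _) (hint _ _),
      intervalIntegral.integral_add_adjacent_intervals (hint _ _) (hint _ _)]
  have h4 : 2 * π / (N * c) ≤ 4 := by
    rw [div_le_iff₀ (by linarith)]; linarith
  have hlogπ : 0 ≤ log π ∧ log π ≤ π := ⟨log_nonneg (by linarith), by
    have := log_le_sub_one_of_pos pi_pos; linarith⟩
  have hlog : log (π / c) = log π + log (1 / c) := by
    rw [log_div (by positivity) hc0.ne', log_div one_ne_zero hc0.ne', log_one]; ring
  have e : 1 / π * (∫ t in (-π)..π, |p t|) - 4 / π ^ 2 * log (1 / c)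
      = 1 / π * (((∫ t in c..π, |p t|) - 2 / π * log (π / c))
        + ((∫ t in (-π)..(-c), |p t|) - 2 / π * log (π / c)) + (∫ t in (-c)..c, |p t|)
        + 4 / π * log π) := by
    rw [hsum, hlog]; field_simp; ring
  have h5 : |4 / π * log π| ≤ 4 := by
    rw [abs_of_nonneg (by have := hlogπ.1; positivity), div_mul_eq_mul_div, div_le_iff₀ pi_pos]
    linarith [hlogπ.2]
  rw [e, abs_mul, abs_of_pos (by positivity), one_div, inv_mul_le_iff₀ pi_pos]
  refine (abs_add_le _ _).trans ((add_le_add ((abs_add_le _ _).trans (add_le_add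
    ((abs_add_le _ _).trans (add_le_add h1 h2)) h3)) h5).trans ?_)
  nlinarith

/-! ### Absolutely convergent trigonometric series and their Fourier sums -/

section TrigSeries

theorem hasSum_intervalIntegral_mul {F : ℕ → ℝ → ℝ} (hF : ∀ k, Continuous (F k)) {b : ℕ → ℝ}
    (hb : Summable b) (hFb : ∀ k t, |F k t| ≤ b k) {g : ℝ → ℝ} (hg : Continuous g) (x y : ℝ) :
    HasSum (fun k => ∫ t in x..y, F k t * g t) (∫ t in x..y, (∑' k, F k t) * g t) := by
  have hbi : IntervalIntegrable (fun t => ∑' k, b k * |g t|) MeasureTheory.volume x y := by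
    have hc : Continuous fun t => (∑' k, b k) * |g t| := continuous_const.mul hg.abs
    simpa only [tsum_mul_right] using hc.intervalIntegrable x y
  refine intervalIntegral.hasSum_integral_of_dominated_convergence (fun k t => b k * |g t|)
    (fun k => ((hF k).mul hg).aestronglyMeasurable) (fun k => .of_forall fun t _ => ?_)
    (.of_forall fun t _ => hb.mul_right _) ?_ (.of_forall fun t _ => ?_)
  · simp only [norm_mul, norm_eq_abs]
    exact mul_le_mul_of_nonneg_right (hFb k t) (abs_nonneg (g t))
  · exact hbi
  · have hs : Summable fun k => F k t := Summable.of_norm_bounded hb fun k => hFb k t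
    exact hs.hasSum.mul_right (g t)

theorem integral_cos_intCast_mul (j : ℤ) :
    ∫ t in (-π)..π, cos (j * t) = if j = 0 then 2 * π else 0 := by
  split_ifs with h
  · simp [h]; ring
  · have hj : (j : ℝ) ≠ 0 := by exact_mod_cast h
    rw [intervalIntegral.integral_comp_mul_left (fun t => cos t) hj, integral_cos, mul_neg, sin_neg,
      sin_int_mul_pi]
    simp

theorem integral_sin_mul (c : ℝ) : ∫ t in (-π)..π, sin (c * t) = 0 := by
  have h := intervalIntegral.integral_comp_neg (a := -π) (b := π) (fun t => sin (c * t))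
  simp only [mul_neg, sin_neg, intervalIntegral.integral_neg, neg_neg] at h
  linarith

theorem integral_cos_mul_cos (k m : ℕ) :
    ∫ t in (-π)..π, cos (((k + 1 : ℕ) : ℝ) * t) * cos (m * t) = if k + 1 = m then π else 0 := by
  have h : ∀ t : ℝ, cos (((k + 1 : ℕ) : ℝ) * t) * cos (m * t)
      = 1 / 2 * (cos (((k + 1 - m : ℤ) : ℝ) * t) + cos (((k + 1 + m : ℤ) : ℝ) * t)) := fun t => by
    push_cast
    rw [sub_mul, add_mul _ (m : ℝ), cos_sub, cos_add]; ring
  simp only [h]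
  rw [intervalIntegral.integral_const_mul, intervalIntegral.integral_add
    ((by fun_prop : Continuous _).intervalIntegrable _ _)
    ((by fun_prop : Continuous _).intervalIntegrable _ _),
    integral_cos_intCast_mul, integral_cos_intCast_mul, if_neg (by omega : ¬ (k + 1 + m : ℤ) = 0)]
  by_cases hkm : k + 1 = m
  · rw [if_pos hkm, if_pos (by omega)]; ring
  · rw [if_neg hkm, if_neg (by omega)]; ring

theorem integral_sin_mul_sin (k m : ℕ) :
    ∫ t in (-π)..π, sin (((k + 1 : ℕ) : ℝ) * t) * sin (m * t) = if k + 1 = m then π else 0 := by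
  have h : ∀ t : ℝ, sin (((k + 1 : ℕ) : ℝ) * t) * sin (m * t)
      = 1 / 2 * (cos (((k + 1 - m : ℤ) : ℝ) * t) - cos (((k + 1 + m : ℤ) : ℝ) * t)) := fun t => by
    push_cast
    rw [sub_mul, add_mul _ (m : ℝ), cos_sub, cos_add]; ring
  simp only [h]
  rw [intervalIntegral.integral_const_mul, intervalIntegral.integral_sub
    ((by fun_prop : Continuous _).intervalIntegrable _ _)
    ((by fun_prop : Continuous _).intervalIntegrable _ _),
    integral_cos_intCast_mul, integral_cos_intCast_mul, if_neg (by omega : ¬ (k + 1 + m : ℤ) = 0)]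
  by_cases hkm : k + 1 = m
  · rw [if_pos hkm, if_pos (by omega)]; ring
  · rw [if_neg hkm, if_neg (by omega)]; ring

theorem integral_sin_mul_cos (x y : ℝ) : ∫ t in (-π)..π, sin (x * t) * cos (y * t) = 0 := by
  have h := intervalIntegral.integral_comp_neg (a := -π) (b := π)
    (fun t => sin (x * t) * cos (y * t))
  simp only [mul_neg, sin_neg, cos_neg, neg_mul, intervalIntegral.integral_neg, neg_neg] at h
  linarith

/-- The sum of a trigonometric series. -/
def trigSeries (c : ℝ) (u v : ℕ → ℝ) (x : ℝ) : ℝ :=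
  c / 2 + ∑' k : ℕ, (u k * cos (((k + 1 : ℕ) : ℝ) * x) + v k * sin (((k + 1 : ℕ) : ℝ) * x))

theorem abs_trigTerm_le (u v x y : ℝ) : |u * cos x + v * sin y| ≤ |u| + |v| := by
  refine (abs_add_le _ _).trans ?_
  rw [abs_mul, abs_mul]
  exact add_le_add (mul_le_of_le_one_right (abs_nonneg _) (abs_cos_le_one _))
    (mul_le_of_le_one_right (abs_nonneg _) (abs_sin_le_one _))

variable {c : ℝ} {u v : ℕ → ℝ}

theorem summable_trigTerm (hu : Summable fun k => |u k|) (hv : Summable fun k => |v k|) (x : ℝ) :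
    Summable fun k : ℕ =>
      u k * cos (((k + 1 : ℕ) : ℝ) * x) + v k * sin (((k + 1 : ℕ) : ℝ) * x) :=
  Summable.of_norm_bounded (hu.add hv) fun _ => abs_trigTerm_le _ _ _ _

theorem integral_trigSeries_mul (hu : Summable fun k => |u k|) (hv : Summable fun k => |v k|)
    {g : ℝ → ℝ} (hg : Continuous g) :
    ∫ t in (-π)..π, trigSeries c u v t * g t = c / 2 * (∫ t in (-π)..π, g t)
      + ∑' k : ℕ, (u k * (∫ t in (-π)..π, cos (((k + 1 : ℕ) : ℝ) * t) * g t)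
        + v k * ∫ t in (-π)..π, sin (((k + 1 : ℕ) : ℝ) * t) * g t) := by
  have hF : ∀ k : ℕ, Continuous fun t : ℝ =>
      u k * cos (((k + 1 : ℕ) : ℝ) * t) + v k * sin (((k + 1 : ℕ) : ℝ) * t) := fun k => by fun_prop
  have h := hasSum_intervalIntegral_mul hF (hu.add hv) (fun _ _ => abs_trigTerm_le _ _ _ _) hg
    (-π) π
  have hc : Continuous fun t : ℝ => ∑' k : ℕ,
      (u k * cos (((k + 1 : ℕ) : ℝ) * t) + v k * sin (((k + 1 : ℕ) : ℝ) * t)) :=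
    continuous_tsum hF (hu.add hv) fun _ _ => abs_trigTerm_le _ _ _ _
  simp only [trigSeries, add_mul _ _ (g _)]
  rw [intervalIntegral.integral_add ((by fun_prop : Continuous _).intervalIntegrable _ _)
    ((by fun_prop : Continuous _).intervalIntegrable _ _), intervalIntegral.integral_const_mul, ← h.tsum_eq]
  congr 1
  refine tsum_congr fun k => ?_
  rw [← intervalIntegral.integral_const_mul, ← intervalIntegral.integral_const_mul,
    ← intervalIntegral.integral_add ((by fun_prop : Continuous _).intervalIntegrable _ _)
      ((by fun_prop : Continuous _).intervalIntegrable _ _)]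
  exact intervalIntegral.integral_congr fun t _ => by ring

theorem cosCoeff_trigSeries_zero (hu : Summable fun k => |u k|) (hv : Summable fun k => |v k|) :
    cosCoeff (trigSeries c u v) 0 = c := by
  rw [cosCoeff, integral_trigSeries_mul hu hv (by fun_prop)]
  simp only [integral_cos_mul_cos, integral_sin_mul_cos]
  simp
  field_simp
  norm_num

theorem cosCoeff_trigSeries_succ (hu : Summable fun k => |u k|) (hv : Summable fun k => |v k|)
    (m : ℕ) : cosCoeff (trigSeries c u v) (m + 1) = u m := by
  rw [cosCoeff, integral_trigSeries_mul hu hv (by fun_prop)]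
  simp only [integral_cos_mul_cos, integral_sin_mul_cos]
  have := integral_cos_intCast_mul (m + 1)
  rw [if_neg (by omega)] at this
  push_cast at this ⊢
  rw [this]
  simp
  field_simp

theorem sinCoeff_trigSeries_succ (hu : Summable fun k => |u k|) (hv : Summable fun k => |v k|)
    (m : ℕ) : sinCoeff (trigSeries c u v) (m + 1) = v m := by
  have h0 : ∀ k : ℕ, ∫ t in (-π)..π, cos (((k + 1 : ℕ) : ℝ) * t) * sin (((m + 1 : ℕ) : ℝ) * t) = 0 :=
    fun k => by simpa only [mul_comm] using integral_sin_mul_cos ((m + 1 : ℕ) : ℝ) ((k + 1 : ℕ) : ℝ)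
  rw [sinCoeff, integral_trigSeries_mul hu hv (by fun_prop)]
  simp only [integral_sin_mul_sin, integral_sin_mul, h0]
  simp
  field_simp

theorem sum_Icc_one_eq_sum_range {M : Type*} [AddCommMonoid M] (f : ℕ → M) (m : ℕ) :
    ∑ k ∈ Finset.Icc 1 m, f k = ∑ k ∈ Finset.range m, f (k + 1) := by
  induction m with
  | zero => simp
  | succ m ih => rw [Finset.sum_Icc_succ_top (by omega), ih, Finset.sum_range_succ]

/-- Index `k` carries frequency `k + 1`, so `n ≤ k + 1` selects the frequencies that the Fourier sum
of order `n - 1` leaves over. -/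
theorem rho_trigSeries (hu : Summable fun k => |u k|) (hv : Summable fun k => |v k|) (n : ℕ)
    (x : ℝ) :
    rho n (trigSeries c u v) x = ∑' k : ℕ, if n ≤ k + 1 then
      u k * cos (((k + 1 : ℕ) : ℝ) * x) + v k * sin (((k + 1 : ℕ) : ℝ) * x) else 0 := by
  set f : ℕ → ℝ := fun k =>
    u k * cos (((k + 1 : ℕ) : ℝ) * x) + v k * sin (((k + 1 : ℕ) : ℝ) * x) with hf
  have hS : fourierSum (n - 1) (trigSeries c u v) x = c / 2 + ∑ k ∈ Finset.range (n - 1), f k := by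
    rw [fourierSum, sum_Icc_one_eq_sum_range]
    simp only [cosCoeff_trigSeries_zero hu hv, cosCoeff_trigSeries_succ hu hv,
      sinCoeff_trigSeries_succ hu hv, hf]
  have h1 : HasSum (fun k => if n ≤ k + 1 then 0 else f k) (∑ k ∈ Finset.range (n - 1), f k) := by
    have e : ∑ k ∈ Finset.range (n - 1), f k
        = ∑ k ∈ Finset.range (n - 1), if n ≤ k + 1 then 0 else f k :=
      Finset.sum_congr rfl fun k hk => by
        rw [Finset.mem_range] at hk; rw [if_neg (by omega)]
    rw [e]
    exact hasSum_sum_of_ne_finset_zero fun k hk => by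
      rw [Finset.mem_range] at hk; rw [if_pos (by omega)]
  have h2 := ((summable_trigTerm hu hv x).hasSum.sub h1).tsum_eq
  rw [rho, hS, trigSeries, add_sub_add_left_eq_sub, ← h2]
  exact tsum_congr fun k => by split_ifs <;> simp [hf]

/-- The sum `∑ w_k cos((k + 1) t - θ)`. -/
def trigKernel (w : ℕ → ℝ) (θ t : ℝ) : ℝ := ∑' k : ℕ, w k * cos (((k + 1 : ℕ) : ℝ) * t - θ)

variable {w : ℕ → ℝ} {θ : ℝ}

theorem abs_mul_cos_le (a x : ℝ) : |a * cos x| ≤ |a| := by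
  rw [abs_mul]; exact mul_le_of_le_one_right (abs_nonneg _) (abs_cos_le_one _)

theorem continuous_trigKernel (hw : Summable fun k => |w k|) : Continuous (trigKernel w θ) :=
  continuous_tsum (fun k => by fun_prop) hw fun _ _ => abs_mul_cos_le _ _

theorem periodic_trigKernel : Function.Periodic (trigKernel w θ) (2 * π) := fun t => by
  refine tsum_congr fun k => ?_
  rw [mul_add, add_sub_right_comm, cos_add_nat_mul_two_pi]

theorem integral_trigKernel_mul (hw : Summable fun k => |w k|) {φ : ℝ → ℝ} (hφ : Continuous φ)
    (x : ℝ) :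
    ∫ t in (-π)..π, trigKernel w θ (x - t) * φ t = ∑' k : ℕ,
      (w k * (∫ t in (-π)..π, cos (((k + 1 : ℕ) : ℝ) * t + θ) * φ t) * cos (((k + 1 : ℕ) : ℝ) * x)
      + w k * (∫ t in (-π)..π, sin (((k + 1 : ℕ) : ℝ) * t + θ) * φ t)
        * sin (((k + 1 : ℕ) : ℝ) * x)) := by
  have h := hasSum_intervalIntegral_mul (F := fun k t => w k * cos (((k + 1 : ℕ) : ℝ) * (x - t) - θ))
    (fun k => by fun_prop) hw (fun _ _ => abs_mul_cos_le _ _) hφ (-π) π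
  refine h.tsum_eq.symm.trans (tsum_congr fun k => ?_)
  rw [mul_comm (_ * _) (cos _), mul_comm (_ * _) (sin _), ← mul_assoc, ← mul_assoc, ← intervalIntegral.integral_const_mul,
    ← intervalIntegral.integral_const_mul,
    ← intervalIntegral.integral_add ((by fun_prop : Continuous _).intervalIntegrable _ _)
      ((by fun_prop : Continuous _).intervalIntegrable _ _)]
  refine intervalIntegral.integral_congr fun t _ => ?_
  have e : ((k + 1 : ℕ) : ℝ) * (x - t) - θ
    = ((k + 1 : ℕ) : ℝ) * x - (((k + 1 : ℕ) : ℝ) * t + θ) := by ring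
  simp only [e, cos_sub]
  ring

theorem abs_integral_mul_le {g φ : ℝ → ℝ} (hφ : Continuous φ) (hg : ∀ t, |g t| ≤ 1) :
    |∫ t in (-π)..π, g t * φ t| ≤ ∫ t in (-π)..π, |φ t| := by
  rw [← norm_eq_abs]
  refine intervalIntegral.norm_integral_le_of_norm_le (by linarith [pi_pos])
    (.of_forall fun t _ => ?_) (hφ.abs.intervalIntegrable _ _)
  rw [norm_mul]
  exact mul_le_of_le_one_left (norm_nonneg _) (hg t)

/-- Expanding the convolution exhibits `f` as a trigonometric series with summable coefficients, so
cutting off its Fourier sum amounts to cutting off the weights of the kernel. -/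
theorem rho_trigConvolution (hw : Summable fun k => |w k|) {φ f : ℝ → ℝ} (hφ : Continuous φ)
    {a : ℝ} (hf : ∀ x, f x = a / 2 + 1 / π * ∫ t in (-π)..π, trigKernel w θ (x - t) * φ t)
    (n : ℕ) (x : ℝ) :
    rho n f x = 1 / π *
      ∫ t in (-π)..π, trigKernel (fun k => if n ≤ k + 1 then w k else 0) θ (x - t) * φ t := by
  set A : ℕ → ℝ := fun k => ∫ t in (-π)..π, cos (((k + 1 : ℕ) : ℝ) * t + θ) * φ t with hA
  set B : ℕ → ℝ := fun k => ∫ t in (-π)..π, sin (((k + 1 : ℕ) : ℝ) * t + θ) * φ t with hB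
  have hAb : ∀ k, |A k| ≤ ∫ t in (-π)..π, |φ t| := fun k =>
    abs_integral_mul_le hφ fun t => abs_cos_le_one _
  have hBb : ∀ k, |B k| ≤ ∫ t in (-π)..π, |φ t| := fun k =>
    abs_integral_mul_le hφ fun t => abs_sin_le_one _
  have hsum : ∀ C : ℕ → ℝ, (∀ k, |C k| ≤ ∫ t in (-π)..π, |φ t|) →
      Summable fun k => |1 / π * (w k * C k)| := fun C hC => by
    refine Summable.of_nonneg_of_le (fun _ => abs_nonneg _) (fun k => ?_)
      ((hw.mul_right (∫ t in (-π)..π, |φ t|)).mul_left (1 / π))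
    rw [abs_mul, abs_mul, abs_of_pos (by positivity)]
    gcongr
    exact hC k
  have hwn : Summable fun k => |if n ≤ k + 1 then w k else 0| :=
    Summable.of_nonneg_of_le (fun _ => abs_nonneg _)
      (fun k => by split_ifs <;> simp) hw
  have hfs : f = trigSeries a (fun k => 1 / π * (w k * A k)) (fun k => 1 / π * (w k * B k)) := by
    funext y
    rw [hf, integral_trigKernel_mul hw hφ, trigSeries, ← tsum_mul_left]
    congr 1
    exact tsum_congr fun k => by ring
  rw [hfs, rho_trigSeries (hsum A hAb) (hsum B hBb), integral_trigKernel_mul hwn hφ, ← tsum_mul_left]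
  refine tsum_congr fun k => ?_
  split_ifs
  · ring
  · ring

theorem trigPoly_eq_trigSeries {m : ℕ} {T : ℝ → ℝ} (hT : T ∈ trigPolys m) :
    ∃ (c : ℝ) (u v : ℕ → ℝ), (∀ k, m ≤ k → u k = 0 ∧ v k = 0) ∧ T = trigSeries c u v := by
  obtain ⟨a, b, h⟩ := hT
  refine ⟨a 0, fun k => if m ≤ k then 0 else a (k + 1), fun k => if m ≤ k then 0 else b (k + 1),
    fun k hk => by simp [hk], funext fun x => ?_⟩
  rw [h, sum_Icc_one_eq_sum_range, trigSeries]
  congr 1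
  rw [tsum_eq_sum (s := Finset.range m) fun k hk => by
    rw [Finset.mem_range, not_lt] at hk; simp [hk]]
  refine Finset.sum_congr rfl fun k hk => ?_
  rw [Finset.mem_range] at hk
  rw [if_neg (by omega), if_neg (by omega)]

theorem trigPoly_isCont2Pi {m : ℕ} {T : ℝ → ℝ} (hT : T ∈ trigPolys m) : IsCont2Pi T := by
  obtain ⟨a, b, h⟩ := hT
  rw [show T = _ from funext h]
  refine ⟨by fun_prop, fun x => ?_⟩
  simp only [mul_add, cos_add_nat_mul_two_pi, sin_add_nat_mul_two_pi]

/-- Orthogonality: the kernel has only frequencies above `m`, where the Fourier coefficients of `T`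
vanish. -/
theorem integral_trigKernel_mul_trigPoly (hw : Summable fun k => |w k|) {m : ℕ}
    (hwm : ∀ k, k < m → w k = 0) {T : ℝ → ℝ} (hT : T ∈ trigPolys m) (x : ℝ) :
    ∫ t in (-π)..π, trigKernel w θ (x - t) * T t = 0 := by
  have hTc := (trigPoly_isCont2Pi hT).1
  obtain ⟨c, u, v, huv, rfl⟩ := trigPoly_eq_trigSeries hT
  have hu : Summable fun k => |u k| := summable_of_ne_finset_zero (s := Finset.range m) fun k hk => by
    rw [Finset.mem_range, not_lt] at hk; simp [huv k hk]
  have hv : Summable fun k => |v k| := summable_of_ne_finset_zero (s := Finset.range m) fun k hk => by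
    rw [Finset.mem_range, not_lt] at hk; simp [huv k hk]
  rw [integral_trigKernel_mul hw hTc]
  refine (tsum_congr fun k => ?_).trans tsum_zero
  rcases lt_or_ge k m with hk | hk
  · simp [hwm k hk]
  · have h1 : ∫ t in (-π)..π, trigSeries c u v t * cos (((k + 1 : ℕ) : ℝ) * t) = 0 := by
      have := cosCoeff_trigSeries_succ (c := c) hu hv k
      rw [(huv k hk).1, cosCoeff] at this
      simpa [pi_ne_zero] using this
    have h2 : ∫ t in (-π)..π, trigSeries c u v t * sin (((k + 1 : ℕ) : ℝ) * t) = 0 := by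
      have := sinCoeff_trigSeries_succ (c := c) hu hv k
      rw [(huv k hk).2, sinCoeff] at this
      simpa [pi_ne_zero] using this
    have h3 : ∀ p q : ℝ, ∫ t in (-π)..π, (p * (trigSeries c u v t * cos (((k + 1 : ℕ) : ℝ) * t))
        + q * (trigSeries c u v t * sin (((k + 1 : ℕ) : ℝ) * t))) = 0 := fun p q => by
      rw [intervalIntegral.integral_add ((by fun_prop : Continuous _).intervalIntegrable _ _)
        ((by fun_prop : Continuous _).intervalIntegrable _ _),
        intervalIntegral.integral_const_mul, intervalIntegral.integral_const_mul, h1, h2]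
      simp
    have h4 : ∫ t in (-π)..π, cos (((k + 1 : ℕ) : ℝ) * t + θ) * trigSeries c u v t = 0 := by
      rw [← h3 (cos θ) (-sin θ)]
      exact intervalIntegral.integral_congr fun t _ => by simp only [cos_add]; ring
    have h5 : ∫ t in (-π)..π, sin (((k + 1 : ℕ) : ℝ) * t + θ) * trigSeries c u v t = 0 := by
      rw [← h3 (sin θ) (cos θ)]
      exact intervalIntegral.integral_congr fun t _ => by simp only [sin_add]; ring
    rw [h4, h5]; ring

end TrigSeries

/-! ### The remainder kernel and its `L¹` norm -/

/-- The coefficients of the generalized Poisson kernel from order `n` on. -/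
def truncWeight (α r : ℝ) (n k : ℕ) : ℝ := if n ≤ k + 1 then expRpow α r ((k + 1 : ℕ) : ℝ) else 0

theorem summable_abs_expRpow {α r : ℝ} (hα : 0 < α) (hr : r ∈ Set.Ioo (0 : ℝ) 1) :
    Summable fun k : ℕ => |expRpow α r ((k + 1 : ℕ) : ℝ)| :=
  (expRpow_summable hα hr).abs

theorem summable_abs_truncWeight {α r : ℝ} (hα : 0 < α) (hr : r ∈ Set.Ioo (0 : ℝ) 1) (n : ℕ) :
    Summable fun k : ℕ => |truncWeight α r n k| :=
  Summable.of_nonneg_of_le (fun _ => abs_nonneg _)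
    (fun k => by unfold truncWeight; split_ifs <;> simp) (summable_abs_expRpow hα hr)

/-- Factoring out the lowest frequency and the leading coefficient leaves a power series on the unit
circle, to which the summation by parts applies. -/
theorem trigKernel_truncWeight_eq {α r θ : ℝ} (hα : 0 < α) (hr : r ∈ Set.Ioo (0 : ℝ) 1) {n : ℕ}
    (hn : 1 ≤ n) (hs : Summable fun k : ℕ => expRpow α r (n + k)) (t : ℝ) :
    trigKernel (truncWeight α r n) θ t = expRpow α r n *
      (Complex.exp ((n * t - θ : ℝ) * Complex.I) *
        ∑' k : ℕ, ((expRpow α r (n + k) / expRpow α r n : ℝ) : ℂ)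
          * Complex.exp (t * Complex.I) ^ k).re := by
  obtain ⟨m, rfl⟩ : ∃ m, n = m + 1 := ⟨n - 1, by omega⟩
  have hq := expRpow_pos α r ((m + 1 : ℕ) : ℝ)
  have hs1 : Summable fun k => truncWeight α r (m + 1) k * cos (((k + 1 : ℕ) : ℝ) * t - θ) :=
    Summable.of_norm_bounded (summable_abs_truncWeight hα hr _) fun _ => abs_mul_cos_le _ _
  have hz : ‖Complex.exp (t * Complex.I)‖ = 1 := Complex.norm_exp_ofReal_mul_I t
  have hs2 : Summable fun k : ℕ => ((expRpow α r ((m + 1 : ℕ) + k) / expRpow α r (m + 1 : ℕ) : ℝ) : ℂ)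
          * Complex.exp (t * Complex.I) ^ k := by
    refine Summable.of_norm_bounded (hs.div_const (expRpow α r (m + 1 : ℕ))) fun k => ?_
    have := expRpow_pos α r ((m + 1 : ℕ) + k)
    rw [norm_mul, norm_pow, hz, one_pow, mul_one, Complex.norm_real, norm_of_nonneg (by positivity)]
  rw [trigKernel, ← hs1.sum_add_tsum_nat_add m, Finset.sum_eq_zero fun k hk => by
    rw [Finset.mem_range] at hk; rw [truncWeight, if_neg (by omega), zero_mul], zero_add,
    ← tsum_mul_left, Complex.re_tsum (hs2.mul_left _), ← tsum_mul_left]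
  refine tsum_congr fun k => ?_
  have e : Complex.exp (((m + 1 : ℕ) * t - θ : ℝ) * Complex.I) *
      (((expRpow α r ((m + 1 : ℕ) + k) / expRpow α r (m + 1 : ℕ) : ℝ) : ℂ)
          * Complex.exp (t * Complex.I) ^ k)
      = ((expRpow α r ((m + 1 : ℕ) + k) / expRpow α r (m + 1 : ℕ) : ℝ) : ℂ)
        * Complex.exp ((((k + m + 1 : ℕ) : ℝ) * t - θ : ℝ) * Complex.I) := by
    rw [← Complex.exp_nat_mul, mul_left_comm, ← Complex.exp_add]
    congr 2
    push_cast
    ring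
  rw [e, Complex.re_ofReal_mul, Complex.exp_ofReal_mul_I_re, truncWeight, if_pos (by omega),
    ← mul_assoc, mul_div_cancel₀ _ hq.ne']
  congr 2
  push_cast
  ring

theorem abs_norm_trigKernel_truncWeight_sub_le {α r θ : ℝ} (hα : 0 < α)
    (hr : r ∈ Set.Ioo (0 : ℝ) 1) {n : ℕ} (hn : n₁ α r ≤ n) :
    |1 / π * (∫ t in (-π)..π, |trigKernel (truncWeight α r n) θ t|)
      - expRpow α r n * (4 / π ^ 2 * log ((n : ℝ) ^ (1 - r) / (α * r)))| ≤ 100 * expRpow α r n := by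
  obtain ⟨h1, hc1, hM⟩ := one_le_n₁_and_bounds hα hr hn
  have hA : 0 < α * r := mul_pos hα hr.1
  have hn0 : (0 : ℝ) < n := by exact_mod_cast h1
  have hq := expRpow_pos α r n
  set c := α * r / (n : ℝ) ^ (1 - r) with hc
  have hc0 : 0 < c := by positivity
  obtain ⟨hs, ht⟩ := expRpow_summable_tsum_le hα hr hn0 hM hc1
  set a : ℕ → ℝ := fun k => expRpow α r (n + k) / expRpow α r n with ha
  have hap : ∀ k, 0 ≤ a k := fun k => by
    have := expRpow_pos α r (n + k); positivity
  have has : Summable a := hs.div_const _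
  have hasum : ∑' k, a k ≤ 3 / c := by
    rw [tsum_div_const, div_le_iff₀ hq, mul_comm]; exact ht
  have ha0 : a 0 = 1 := by simp [ha, hq.ne']
  have hanti : Antitone a := antitone_nat_of_succ_le fun k => by
    simp only [ha]
    gcongr
    refine expRpow_anti hα hr (by positivity) ?_
    push_cast; linarith
  have hconv : Antitone fun k => a k - a (k + 1) := antitone_nat_of_succ_le fun k => by
    simp only [ha, ← sub_div]
    refine div_le_div_of_nonneg_right ?_ hq.le
    have := expRpow_diff_anti hα hr (x := n + k) (by positivity)
    push_cast
    rw [← add_assoc, show (n : ℝ) + (k + 1 + 1) = n + k + 2 by ring]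
    exact this
  have ha1 : a 0 - a 1 ≤ c := by
    simp only [ha, ← sub_div]
    rw [div_le_iff₀ hq]
    simpa using expRpow_sub_le hα hr hn0
  set D : ℝ → ℂ := fun t => ∑' k : ℕ, (a k : ℂ) * Complex.exp (t * Complex.I) ^ k with hD
  set p : ℝ → ℝ := fun t => trigKernel (truncWeight α r n) θ t / expRpow α r n with hp
  have hpc : Continuous p := (continuous_trigKernel (summable_abs_truncWeight hα hr n)).div_const _
  have hpD : ∀ t, p t = (Complex.exp ((n * t - θ : ℝ) * Complex.I) * D t).re := fun t => by
    simp only [hp, hD, ha]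
    rw [trigKernel_truncWeight_eq hα hr h1 hs, mul_div_cancel_left₀ _ hq.ne']
  have hNc : 2 ≤ (n : ℝ) * c := by
    have e : (n : ℝ) * c = α * r * (n : ℝ) ^ r := by
      rw [hc, rpow_sub hn0, rpow_one]; field_simp
    rwa [e]
  have hmain := abs_integral_abs_sub_log_le (p := p) (N := n) (θ := θ) hpc hc0 hc1 hn0 hNc
    (fun t => by
      rw [hpD]
      refine (Complex.abs_re_le_norm _).trans ?_
      rw [norm_mul, Complex.norm_exp_ofReal_mul_I, one_mul]
      refine (tsum_of_norm_bounded has.hasSum fun k => ?_).trans hasum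
      rw [norm_mul, norm_pow, Complex.norm_exp_ofReal_mul_I, one_pow, mul_one, Complex.norm_real,
        norm_of_nonneg (hap k)])
    (fun t ht0 htπ => by
      have e : |sin (n * t - θ)| / |t|
          = |(Complex.exp ((n * t - θ : ℝ) * Complex.I) * (Complex.I / t)).re| := by
        rw [mul_div_assoc', Complex.div_ofReal_re, Complex.mul_I_re, Complex.exp_ofReal_mul_I_im,
          abs_div, abs_neg]
      rw [hpD, e]
      refine (abs_abs_sub_abs_le_abs_sub _ _).trans ?_
      rw [← Complex.sub_re, ← mul_sub]
      refine (Complex.abs_re_le_norm _).trans ?_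
      rw [norm_mul, Complex.norm_exp_ofReal_mul_I, one_mul]
      exact norm_tsum_exp_sub_le has hap ha0 hanti hconv ha1 ht0 htπ)
  have e : ∀ t, |trigKernel (truncWeight α r n) θ t| = expRpow α r n * |p t| := fun t => by
    simp only [hp]
    rw [abs_div, abs_of_pos hq, mul_div_cancel₀ _ hq.ne']
  have e2 : 1 / c = (n : ℝ) ^ (1 - r) / (α * r) := by rw [hc, one_div_div]
  rw [e2] at hmain
  simp only [e]
  rw [intervalIntegral.integral_const_mul]
  calc _ = expRpow α r n * |1 / π * (∫ t in (-π)..π, |p t|)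
        - 4 / π ^ 2 * log ((n : ℝ) ^ (1 - r) / (α * r))| := by
        rw [← abs_of_pos hq, ← abs_mul, abs_of_pos hq]; congr 1; ring
    _ ≤ _ := by rw [mul_comm]; gcongr

/-! ### Uniform norm and best approximation -/

theorem IsCont2Pi.bddAbove_range_abs {g : ℝ → ℝ} (hg : IsCont2Pi g) :
    BddAbove (Set.range fun x => |g x|) := by
  obtain ⟨C, hC⟩ := (hg.2.isBounded_of_continuous (by positivity) hg.1).exists_norm_le
  exact ⟨C, by rintro _ ⟨x, rfl⟩; exact hC _ ⟨x, rfl⟩⟩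

theorem IsCont2Pi.abs_le_normC {g : ℝ → ℝ} (hg : IsCont2Pi g) (x : ℝ) : |g x| ≤ normC g :=
  le_ciSup hg.bddAbove_range_abs x

theorem normC_nonneg (g : ℝ → ℝ) : 0 ≤ normC g := Real.iSup_nonneg fun _ => abs_nonneg _

theorem normC_const_mul {s : ℝ} (hs : 0 ≤ s) (g : ℝ → ℝ) :
    normC (fun x => s * g x) = s * normC g := by
  simp only [normC, abs_mul, abs_of_nonneg hs]
  exact (Real.mul_iSup_of_nonneg hs _).symm

theorem const_mul_mem_trigPolys {m : ℕ} {T : ℝ → ℝ} (hT : T ∈ trigPolys m) (s : ℝ) :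
    (fun x => s * T x) ∈ trigPolys m := by
  obtain ⟨a, b, h⟩ := hT
  refine ⟨fun k => s * a k, fun k => s * b k, fun x => ?_⟩
  simp only [h, mul_add, Finset.mul_sum]
  congr 1
  · ring
  · exact Finset.sum_congr rfl fun k _ => by ring

theorem const_mem_trigPolys (m : ℕ) (s : ℝ) : (fun _ : ℝ => s) ∈ trigPolys m :=
  ⟨fun k => if k = 0 then 2 * s else 0, fun _ => 0, fun x => by
    rw [Finset.sum_eq_zero fun k hk => by
      rw [Finset.mem_Icc] at hk; simp [show k ≠ 0 by omega]]
    simp⟩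

theorem bestApprox_le {n : ℕ} {φ T : ℝ → ℝ} (hT : T ∈ trigPolys (n - 1)) :
    bestApprox n φ ≤ normC fun x => φ x - T x :=
  csInf_le ⟨0, by rintro _ ⟨T, -, rfl⟩; exact normC_nonneg _⟩ ⟨T, hT, rfl⟩

theorem bestApprox_nonneg (n : ℕ) (φ : ℝ → ℝ) : 0 ≤ bestApprox n φ :=
  Real.sInf_nonneg (by rintro _ ⟨T, -, rfl⟩; exact normC_nonneg _)

/-- Lets each estimate be made for an arbitrary polynomial, so that a best approximant is never
required to exist. -/
theorem le_mul_bestApprox {n : ℕ} {φ : ℝ → ℝ} {x c : ℝ} (hc : 0 ≤ c)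
    (h : ∀ T ∈ trigPolys (n - 1), x ≤ c * normC fun y => φ y - T y) : x ≤ c * bestApprox n φ := by
  rw [bestApprox, ← smul_eq_mul, ← Real.sInf_smul_of_nonneg hc]
  refine le_csInf (Set.Nonempty.smul_set ⟨_, _, const_mem_trigPolys _ 0, rfl⟩) ?_
  rintro _ ⟨_, ⟨T, hT, rfl⟩, rfl⟩
  exact h T hT

theorem bestApprox_const_mul {s : ℝ} (hs : 0 ≤ s) (n : ℕ) (φ : ℝ → ℝ) :
    bestApprox n (fun x => s * φ x) = s * bestApprox n φ := by
  refine le_antisymm (le_mul_bestApprox hs fun T hT => ?_) ?_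
  · rw [← normC_const_mul hs]
    simp only [mul_sub]
    exact bestApprox_le (const_mul_mem_trigPolys hT s)
  · rcases hs.eq_or_lt with rfl | hs
    · rw [zero_mul]; exact bestApprox_nonneg _ _
    · rw [← one_mul (bestApprox n fun x => s * φ x)]
      refine le_mul_bestApprox zero_le_one fun T hT => ?_
      have h := bestApprox_le (φ := φ) (const_mul_mem_trigPolys hT s⁻¹)
      have e : (fun y => s * φ y - T y) = fun y => s * (φ y - s⁻¹ * T y) := funext fun y => by
        field_simp
      rw [one_mul, e, normC_const_mul hs.le]
      gcongr

/-! ### The remainder as a convolution and the upper bound -/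

theorem kernel_eq_trigKernel (α r β : ℝ) :
    kernel α r β = trigKernel (fun k => expRpow α r ((k + 1 : ℕ) : ℝ)) (β * π / 2) := rfl

theorem rho_eq_convolution {α r β : ℝ} (hα : 0 < α) (hr : r ∈ Set.Ioo (0 : ℝ) 1)
    {f φ : ℝ → ℝ} (h : IsGenDeriv α r β f φ) (n : ℕ) (x : ℝ) :
    rho n f x = 1 / π *
      ∫ t in (-π)..π, trigKernel (truncWeight α r n) (β * π / 2) (x - t) * φ t := by
  obtain ⟨hφ, -, -, a, hf⟩ := h
  exact rho_trigConvolution (summable_abs_expRpow hα hr) hφ.1 hf n x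

theorem integral_periodic_sub_left {g : ℝ → ℝ} (hg : Function.Periodic g (2 * π)) (x : ℝ) :
    ∫ t in (-π)..π, g (x - t) = ∫ t in (-π)..π, g t := by
  rw [intervalIntegral.integral_comp_sub_left]
  have h := hg.intervalIntegral_add_eq (x - π) (-π)
  rw [show x - π + 2 * π = x - -π by ring, show -π + 2 * π = π by ring] at h
  exact h

/-- The `L¹` mean `π⁻¹ ‖K_n‖₁` of the remainder kernel. -/
def remainderNorm (α r β : ℝ) (n : ℕ) : ℝ :=
  1 / π * ∫ t in (-π)..π, |trigKernel (truncWeight α r n) (β * π / 2) t|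

theorem remainderNorm_nonneg (α r β : ℝ) (n : ℕ) : 0 ≤ remainderNorm α r β n :=
  mul_nonneg (by positivity)
    (intervalIntegral.integral_nonneg (by linarith [pi_pos]) fun _ _ => abs_nonneg _)

theorem abs_convolution_le {α r : ℝ} (β : ℝ) (hα : 0 < α) (hr : r ∈ Set.Ioo (0 : ℝ) 1) (n : ℕ)
    {ψ : ℝ → ℝ} {M : ℝ} (hM : ∀ t, |ψ t| ≤ M) (x : ℝ) :
    |1 / π * ∫ t in (-π)..π, trigKernel (truncWeight α r n) (β * π / 2) (x - t) * ψ t|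
      ≤ remainderNorm α r β n * M := by
  have hK : Continuous (trigKernel (truncWeight α r n) (β * π / 2)) :=
    continuous_trigKernel (summable_abs_truncWeight hα hr n)
  have hper : Function.Periodic (fun t => |trigKernel (truncWeight α r n) (β * π / 2) t|) (2 * π) :=
    fun t => by simp only [periodic_trigKernel t]
  rw [remainderNorm, ← integral_periodic_sub_left hper x, abs_mul, abs_of_pos (by positivity),
    mul_assoc, ← intervalIntegral.integral_mul_const, ← norm_eq_abs (∫ _ in _.._, _)]
  gcongr
  refine intervalIntegral.norm_integral_le_of_norm_le (by linarith [pi_pos])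
    (.of_forall fun t _ => ?_) ((by fun_prop : Continuous _).intervalIntegrable _ _)
  rw [norm_mul, norm_eq_abs, norm_eq_abs]
  exact mul_le_mul_of_nonneg_left (hM t) (abs_nonneg _)

theorem truncWeight_eq_zero {α r : ℝ} {n k : ℕ} (hk : k < n - 1) : truncWeight α r n k = 0 :=
  if_neg (by omega)

theorem abs_rho_le {α r β : ℝ} (hα : 0 < α) (hr : r ∈ Set.Ioo (0 : ℝ) 1) {f φ : ℝ → ℝ}
    (h : IsGenDeriv α r β f φ) (n : ℕ) (x : ℝ) :
    |rho n f x| ≤ remainderNorm α r β n * bestApprox n φ := by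
  have hK : Continuous (trigKernel (truncWeight α r n) (β * π / 2)) :=
    continuous_trigKernel (summable_abs_truncWeight hα hr n)
  have hφ := h.1
  refine le_mul_bestApprox (remainderNorm_nonneg _ _ _ _) fun T hT => ?_
  have hTc := trigPoly_isCont2Pi hT
  have hd : IsCont2Pi fun y => φ y - T y := ⟨hφ.1.sub hTc.1, hφ.2.sub hTc.2⟩
  have hφ1 := hφ.1
  have hT1 := hTc.1
  have e : rho n f x = 1 / π * ∫ t in (-π)..π,
      trigKernel (truncWeight α r n) (β * π / 2) (x - t) * (φ t - T t) := by
    rw [rho_eq_convolution hα hr h]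
    simp only [mul_sub]
    rw [intervalIntegral.integral_sub ((by fun_prop : Continuous _).intervalIntegrable _ _)
      ((by fun_prop : Continuous _).intervalIntegrable _ _),
      integral_trigKernel_mul_trigPoly (summable_abs_truncWeight hα hr n)
        (fun k hk => truncWeight_eq_zero hk) hT, sub_zero]
  rw [e]
  exact abs_convolution_le β hα hr n (fun t => hd.abs_le_normC t) x

theorem normC_rho_le {α r β : ℝ} (hα : 0 < α) (hr : r ∈ Set.Ioo (0 : ℝ) 1) {f φ : ℝ → ℝ}
    (h : IsGenDeriv α r β f φ) (n : ℕ) :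
    normC (rho n f) ≤ remainderNorm α r β n * bestApprox n φ :=
  ciSup_le fun x => abs_rho_le hα hr h n x

/-! ### Sharpness of the upper bound -/

/-- Testing the kernel on `cos (nt)` gives `q cos (nx - θ)`, whose value at `x = θ/n` is `q`. This
lower bound keeps the near-extremal remainder nonzero when `ε` is a small multiple of `q`. -/
theorem expRpow_le_remainderNorm {α r : ℝ} (β : ℝ) (hα : 0 < α) (hr : r ∈ Set.Ioo (0 : ℝ) 1)
    {n : ℕ} (hn : 1 ≤ n) : expRpow α r n ≤ remainderNorm α r β n := by
  set θ := β * π / 2 with hθ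
  have hcos : ∀ k : ℕ, ∫ t in (-π)..π, cos (((k + 1 : ℕ) : ℝ) * t + θ) * cos (n * t)
      = cos θ * if k + 1 = n then π else 0 := fun k => by
    have h1 := integral_cos_mul_cos k n
    have h2 := integral_sin_mul_cos ((k + 1 : ℕ) : ℝ) (n : ℝ)
    simp only [cos_add, sub_mul, mul_right_comm (cos (_ * _)), mul_right_comm (sin (_ * _))]
    rw [intervalIntegral.integral_sub ((by fun_prop : Continuous _).intervalIntegrable _ _)
      ((by fun_prop : Continuous _).intervalIntegrable _ _), intervalIntegral.integral_mul_const,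
      intervalIntegral.integral_mul_const, h1, h2]
    ring
  have hsin : ∀ k : ℕ, ∫ t in (-π)..π, sin (((k + 1 : ℕ) : ℝ) * t + θ) * cos (n * t)
      = sin θ * if k + 1 = n then π else 0 := fun k => by
    have h1 := integral_cos_mul_cos k n
    have h2 := integral_sin_mul_cos ((k + 1 : ℕ) : ℝ) (n : ℝ)
    simp only [sin_add, add_mul, mul_right_comm (cos (_ * _)), mul_right_comm (sin (_ * _))]
    rw [intervalIntegral.integral_add ((by fun_prop : Continuous _).intervalIntegrable _ _)
      ((by fun_prop : Continuous _).intervalIntegrable _ _), intervalIntegral.integral_mul_const,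
      intervalIntegral.integral_mul_const, h1, h2]
    ring
  have h := abs_convolution_le β hα hr n (ψ := fun t => cos (n * t)) (M := 1)
    (fun t => abs_cos_le_one _) (θ / n)
  rw [mul_one, integral_trigKernel_mul (summable_abs_truncWeight hα hr n) (by fun_prop)] at h
  simp only [← hθ, hcos, hsin] at h
  have hn0 : (n : ℝ) ≠ 0 := by exact_mod_cast (by omega : n ≠ 0)
  have hkn : n - 1 + 1 = n := by omega
  rw [tsum_eq_single (n - 1) fun k hk => by rw [if_neg (by omega)]; ring, hkn, if_pos rfl,
    mul_div_cancel₀ _ hn0, truncWeight, hkn, if_pos le_rfl] at h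
  have e : 1 / π * (expRpow α r n * (cos θ * π) * cos θ + expRpow α r n * (sin θ * π) * sin θ)
      = expRpow α r n := by
    field_simp
    linear_combination expRpow α r n * cos_sq_add_sin_sq θ
  rw [e] at h
  exact (le_abs_self _).trans h

/-- The root is at most `|x| + ε`, and `(|x| - ε)(|x| + ε) ≤ x²`. Thus `x / √(x² + ε²)` acts as a
continuous sign of `x` with loss at most `ε`. -/
theorem abs_sub_le_sq_div_sqrt (x : ℝ) {ε : ℝ} (hε : 0 < ε) :
    |x| - ε ≤ x * (x / √(x ^ 2 + ε ^ 2)) := by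
  have hs : 0 < √(x ^ 2 + ε ^ 2) := sqrt_pos.2 (by positivity)
  have hle : √(x ^ 2 + ε ^ 2) ≤ |x| + ε := by
    rw [sqrt_le_left (by positivity)]
    nlinarith [sq_abs x, abs_nonneg x]
  rw [← mul_div_assoc, le_div_iff₀ hs]
  rcases le_total |x| ε with h | h
  · nlinarith [mul_self_nonneg x]
  · nlinarith [sq_abs x]

/-- The sign of `K(-t)` would be extremal at the point `0` but need not be continuous, so it is
replaced by `g = K / √(K² + ε²)`. Integrating the loss `ε` over a period and dividing by `π` gives
`2ε`. -/
theorem exists_genDeriv_near_extremal {α r : ℝ} (β : ℝ) (hα : 0 < α) (hr : r ∈ Set.Ioo (0 : ℝ) 1)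
    {n : ℕ} {ε : ℝ} (hε : 0 < ε) :
    ∃ F Φ : ℝ → ℝ, IsGenDeriv α r β F Φ ∧ bestApprox n Φ ≤ 1 ∧
      remainderNorm α r β n - 2 * ε ≤ normC (rho n F) := by
  set K := trigKernel (truncWeight α r n) (β * π / 2) with hKdef
  have hK : Continuous K := continuous_trigKernel (summable_abs_truncWeight hα hr n)
  have hKper : Function.Periodic K (2 * π) := periodic_trigKernel
  have hKabs : Function.Periodic (fun t => |K t|) (2 * π) := fun t => by simp only [hKper t]
  set g : ℝ → ℝ := fun t => K (0 - t) / √(K (0 - t) ^ 2 + ε ^ 2) with hg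
  have hspos : ∀ t, 0 < √(K (0 - t) ^ 2 + ε ^ 2) := fun t => sqrt_pos.2 (by positivity)
  have hgc : Continuous g := Continuous.div (by fun_prop) (by fun_prop) fun t => (hspos t).ne'
  have hgper : Function.Periodic g (2 * π) := fun t => by
    have : K (0 - (t + 2 * π)) = K (0 - t) := by
      rw [← hKper (0 - (t + 2 * π))]; congr 1; ring
    simp only [hg, this]
  have hg1 : ∀ t, |g t| ≤ 1 := fun t => by
    simp only [hg]
    rw [abs_div, abs_of_pos (hspos t), div_le_one (hspos t)]
    exact abs_le_sqrt (by nlinarith)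
  -- Derivatives in the class have mean zero. Subtracting the mean is harmless: a constant is an
  -- admissible polynomial, so it changes neither the convolution with `K` nor the best
  -- approximation.
  set μ : ℝ := 1 / (2 * π) * ∫ t in (-π)..π, g t with hμ
  set Φ : ℝ → ℝ := fun t => g t - μ with hΦ
  have hΦmean : ∫ t in (-π)..π, Φ t = 0 := by
    simp only [hΦ]
    rw [intervalIntegral.integral_sub (hgc.intervalIntegrable _ _) (by simp),
      intervalIntegral.integral_const, hμ, smul_eq_mul]
    field_simp
    ring
  set F : ℝ → ℝ := fun x => 0 / 2 + 1 / π * ∫ t in (-π)..π, kernel α r β (x - t) * Φ t with hF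
  have hgen : IsGenDeriv α r β F Φ := by
    refine ⟨⟨by fun_prop, fun t => by simp only [hΦ, hgper t]⟩, hΦmean, fun x => ?_, 0,
      fun x => rfl⟩
    simp only [hF, add_sub_right_comm x, kernel_eq_trigKernel, periodic_trigKernel _]
  refine ⟨F, Φ, hgen, ?_, ?_⟩
  · refine (bestApprox_le (const_mem_trigPolys _ (-μ))).trans (ciSup_le fun x => ?_)
    simpa [hΦ] using hg1 x
  -- A real supremum over an unbounded set is `0` by default, so boundedness is needed before a
  -- point value can bound the norm from below.
  · have hb : BddAbove (Set.range fun x => |rho n F x|) :=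
      ⟨_, by rintro _ ⟨x, rfl⟩; exact abs_rho_le hα hr hgen n x⟩
    refine le_trans ?_ ((le_abs_self _).trans (le_ciSup hb 0))
    have h0 : ∫ t in (-π)..π, K (0 - t) * μ = 0 :=
      integral_trigKernel_mul_trigPoly (summable_abs_truncWeight hα hr n)
        (fun k hk => truncWeight_eq_zero hk) (const_mem_trigPolys (n - 1) μ) 0
    have e1 : rho n F 0 = 1 / π * ∫ t in (-π)..π, K (0 - t) * g t := by
      rw [rho_eq_convolution hα hr hgen]
      simp only [hΦ, mul_sub, ← hKdef]
      rw [intervalIntegral.integral_sub ((by fun_prop : Continuous _).intervalIntegrable _ _)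
        ((by fun_prop : Continuous _).intervalIntegrable _ _), h0, sub_zero]
    have e2 : remainderNorm α r β n - 2 * ε = 1 / π * ∫ t in (-π)..π, (|K (0 - t)| - ε) := by
      rw [intervalIntegral.integral_sub ((by fun_prop : Continuous _).intervalIntegrable _ _)
        (by simp), integral_periodic_sub_left hKabs, intervalIntegral.integral_const,
        remainderNorm, smul_eq_mul, ← hKdef]
      field_simp
      ring
    rw [e1, e2]
    gcongr
    refine intervalIntegral.integral_mono_on (by linarith [pi_pos])
      ((by fun_prop : Continuous _).intervalIntegrable _ _)
      ((by fun_prop : Continuous _).intervalIntegrable _ _) fun t _ => ?_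
    exact abs_sub_le_sq_div_sqrt _ hε

theorem IsGenDeriv.const_mul {α r β : ℝ} {f φ : ℝ → ℝ} (h : IsGenDeriv α r β f φ) (s : ℝ) :
    IsGenDeriv α r β (fun x => s * f x) fun x => s * φ x := by
  obtain ⟨⟨hc, hp⟩, h0, hf, a, hrep⟩ := h
  refine ⟨⟨by fun_prop, fun x => by simp only [hp x]⟩, ?_, fun x => by simp only [hf x], s * a,
    fun x => ?_⟩
  · rw [intervalIntegral.integral_const_mul, h0, mul_zero]
  · simp only [mul_left_comm _ s]
    rw [intervalIntegral.integral_const_mul, hrep]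
    ring

theorem rho_const_mul {α r β : ℝ} (hα : 0 < α) (hr : r ∈ Set.Ioo (0 : ℝ) 1) {f φ : ℝ → ℝ}
    (h : IsGenDeriv α r β f φ) (n : ℕ) (s : ℝ) :
    rho n (fun x => s * f x) = fun x => s * rho n f x := by
  funext x
  rw [rho_eq_convolution hα hr (h.const_mul s), rho_eq_convolution hα hr h]
  simp only [mul_left_comm _ s]
  rw [intervalIntegral.integral_const_mul]
  ring

end
end GenPoisson

/-! ### Assembly of the two estimates -/

theorem theorem1 (α r β : ℝ) (hα : 0 < α) (hr : r ∈ Set.Ioo (0 : ℝ) 1)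
    (n : ℕ) (hn : n₁ α r ≤ n) :
    (∃ γ : ℝ, |γ| ≤ 20 * Real.pi ^ 4 ∧
      ∀ f ∈ genPoissonClass α r β, ∀ φ : ℝ → ℝ, IsGenDeriv α r β f φ →
        normC (rho n f) ≤ Real.exp (-α * (n : ℝ) ^ r) *
          (4 / Real.pi ^ 2 * Real.log ((n : ℝ) ^ (1 - r) / (α * r)) + γ) * bestApprox n φ) ∧
    (∃ γ : ℝ, |γ| ≤ 20 * Real.pi ^ 4 ∧
      ∀ f ∈ genPoissonClass α r β, ∀ φ : ℝ → ℝ, IsGenDeriv α r β f φ →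
        ∃ F ∈ genPoissonClass α r β, ∃ Φ : ℝ → ℝ, IsGenDeriv α r β F Φ ∧
          bestApprox n Φ = bestApprox n φ ∧
          normC (rho n F) = Real.exp (-α * (n : ℝ) ^ r) *
            (4 / Real.pi ^ 2 * Real.log ((n : ℝ) ^ (1 - r) / (α * r)) + γ) * bestApprox n φ) := by
  have h1 := (one_le_n₁_and_bounds hα hr hn).1
  have hq := expRpow_pos α r n
  rw [show Real.exp (-α * (n : ℝ) ^ r) = expRpow α r n from rfl]
  set q := expRpow α r n
  set l := 4 / Real.pi ^ 2 * Real.log ((n : ℝ) ^ (1 - r) / (α * r))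
  have hI : |remainderNorm α r β n - q * l| ≤ 100 * q :=
    abs_norm_trigKernel_truncWeight_sub_le hα hr hn
  have hqI : q ≤ remainderNorm α r β n := expRpow_le_remainderNorm β hα hr h1
  set I := remainderNorm α r β n
  have hπ : 101 ≤ 20 * Real.pi ^ 4 := by
    have := pow_le_pow_left₀ (by norm_num) Real.pi_gt_three.le 4
    linarith
  rw [abs_le] at hI
  constructor
  -- For an upper bound the largest admissible constant serves, since `I ≤ q (l + 100)`.
  · refine ⟨20 * Real.pi ^ 4, by rw [abs_of_nonneg (by positivity)], fun f _ φ hφ => ?_⟩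
    refine (normC_rho_le hα hr hφ n).trans
      (mul_le_mul_of_nonneg_right ?_ (bestApprox_nonneg _ _))
    nlinarith [hI.2]
  -- One near-extremal pair, chosen independently of `f`, serves every `f` after scaling. With `ε =
  -- q/4` the loss is `q/2`, and `q ≤ I` keeps the remainder, and hence `E_n(Φ)`, positive.
  · obtain ⟨F, Φ, hgen, hE1, hlow⟩ := exists_genDeriv_near_extremal (n := n) β hα hr
      (show 0 < q / 4 by positivity)
    have hup : normC (rho n F) ≤ I * bestApprox n Φ := normC_rho_le hα hr hgen n
    have hρ : 0 < normC (rho n F) := by linarith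
    have hE : 0 < bestApprox n Φ :=
      pos_of_mul_pos_right (hρ.trans_le hup) (hq.le.trans hqI)
    set c := normC (rho n F) / bestApprox n Φ with hc
    have hcup : c ≤ I := by rwa [hc, div_le_iff₀ hE]
    have hclow : I - 2 * (q / 4) ≤ c := hlow.trans (by
      rw [hc, le_div_iff₀ hE]; exact mul_le_of_le_one_right hρ.le hE1)
    -- This value turns the required equality into the definition of `c`. As `I - q/2 ≤ c ≤ I` and
    -- `I` is within `100 q` of `q l`, its modulus is at most `101`.
    refine ⟨c / q - l, ?_, fun f _ φ hφ => ?_⟩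
    · refine le_trans ?_ hπ
      rw [abs_le, neg_le_sub_iff_le_add, sub_le_iff_le_add, div_le_iff₀ hq,
        ← sub_le_iff_le_add, le_div_iff₀ hq]
      constructor <;> nlinarith [hI.1, hI.2]
    -- Scaling by this ratio gives the prescribed best approximation; if that is `0`, the scaled
    -- function is zero and the equality still holds.
    · have hs : 0 ≤ bestApprox n φ / bestApprox n Φ := div_nonneg (bestApprox_nonneg _ _) hE.le
      have hgen' := hgen.const_mul (bestApprox n φ / bestApprox n Φ)
      refine ⟨_, ⟨_, hgen'⟩, _, hgen', ?_, ?_⟩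
      · rw [bestApprox_const_mul hs, div_mul_cancel₀ _ hE.ne']
      · rw [rho_const_mul hα hr hgen, normC_const_mul hs, add_sub_cancel, mul_div_cancel₀ _ hq.ne',
          hc]
        ring
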